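/- **Definitions.** A (finite) graph is a (finite) set $V(A)$ with a reflexive symmetric edge relation $E(A)\subseteq V(A)^2$. An epimorphism is a map of vertices that preserves edges and is onto on vertices and on edges. A set of vertices is connected if it is not a union of two nonempty sets with no edge between them; components are maximal connected subsets. An epimorphism $f\colon G\to H$ is confluent if $f(C)=Q$ for every connected $Q\subseteq V(H)$ and every component $C$ of $f^{-1}(Q)$. A cycle is a graph with $n\ge 3$ vertices $c_0,\dots,c_{n-1}$ in which distinct vertices are adjacent exactly when they are cyclically consecutive. The winding number of a confluent epimorphism $f$ between cycles is the number of components of $f^{-1}(c)$, which is the same for every vertex $c$. A projective Fraïssé class $\mathcal D$ is a class of finite graphs together with a fixed class of epimorphisms between its members ("the epimorphisms of $\mathcal D$") such that: (1) $\mathcal D$ is countable up to isomorphism, where $A,B$ are isomorphic if there are mutually inverse epimorphisms of $\mathcal D$ between them; (2) the epimorphisms of $\mathcal D$ contain the identities and are closed under composition; (3) any $B,C\in\mathcal D$ admit epimorphisms of $\mathcal D$ from some common $E\in\mathcal D$; (4) for epimorphisms $f\colon B\to A$, $g\colon C\to A$ of $\mathcal D$ there are $E\in\mathcal D$ and epimorphisms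 $f_0\colon E\to B$, $g_0\colon E\to C$ of $\mathcal D$ with $f f_0=g g_0$. A topological graph is a zero-dimensional compact metrizable space with a closed, reflexive, symmetric edge relation. The projective Fraïssé limit $\mathbb D$ of $\mathcal D$ is a topological graph isomorphic to an inverse limit (edges taken coordinatewise) of a sequence $\{F_n,\alpha_n\}$ of members and epimorphisms of $\mathcal D$ such that, calling a map $\mathbb D\to A$ ($A\in\mathcal D$) admissible if it is a projection $\mathbb D\to F_n$ followed by an epimorphism $F_n\to A$ of $\mathcal D$: every $A\in\mathcal D$ is the image of an admissible map; for every admissible $f\colon\mathbb D\to A$ and every epimorphism $g\colon B\to A$ of $\mathcal D$ there is an admissible $h\colon\mathbb D\to B$ with $f=gh$; and for every $\varepsilon>0$ there is an admissible map all of whose fibres have diameter less than $\varepsilon$. If $E(\mathbb D)$ is transitive, the topological realization $|\mathbb D|$ is the quotient space $\mathbb D/E(\mathbb D)$. A solenoid is a space homeomorphic to $\varprojlim\{S^1,z^{n_i}\}$ for some integers $n_i\ge 1$ (so the circle counts as the trivial solenoid); a nontrivial solenoid is one for which all $n_i\ge 2$ can be taken. **Proposition.** Let $\mathcal D$ be a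 projective Fraïssé class of cycles with confluent epimorphisms (not necessarily all cycles, nor all confluent epimorphisms between its members). Suppose that - for every $C\in\mathcal D$ there is an epimorphism $f\colon B\to C$ of $\mathcal D$ such that for every $x\in C$ every component of $f^{-1}(x)$ has at least two vertices, and - the set $W_{\mathcal D}$ of winding numbers of epimorphisms of $\mathcal D$ is infinite. Then $\mathcal D$ has a projective Fraïssé limit, and for the projective Fraïssé limit $\mathbb D$ the relation $E(\mathbb D)$ is transitive, so that $|\mathbb D|$ exists, and $|\mathbb D|$ is a solenoid. If moreover, for some single $C\in\mathcal D$, infinitely many integers are winding numbers of epimorphisms of $\mathcal D$ onto $C$, then $|\mathbb D|$ is a nontrivial solenoid. -/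

import Mathlib

universe u v

namespace FraisseCycles

/-- A finite graph: a finite vertex set with a reflexive and symmetric edge relation. -/
structure FinGraph where
  V : Type u
  finite : Finite V
  Adj : V → V → Prop
  refl : ∀ a, Adj a a
  symm : ∀ a b, Adj a b → Adj b a

instance FinGraph.instFinite (A : FinGraph.{u}) : Finite A.V := A.finite

/-- The vertex set of a finite graph carries the discrete topology. -/
instance FinGraph.instTopologicalSpace (A : FinGraph.{u}) : TopologicalSpace A.V := ⊥

instance FinGraph.instDiscreteTopology (A : FinGraph.{u}) : DiscreteTopology A.V := ⟨rfl⟩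

instance FinGraph.instSecondCountableTopology (A : FinGraph.{u}) :
    SecondCountableTopology A.V := inferInstance

/-- A topological graph: a zero-dimensional compact metrizable space of vertices with a closed,
reflexive and symmetric edge relation. (A compact Hausdorff space is zero-dimensional if and only
if it is totally disconnected, and metrizable if and only if it is second countable.) -/
structure TopGraph where
  V : Type u
  top : TopologicalSpace V
  compact : CompactSpace V
  t2 : T2Space V
  totallyDisconnected : TotallyDisconnectedSpace V
  secondCountable : SecondCountableTopology V
  Adj : V → V → Prop
  refl : ∀ a, Adj a a
  symm : ∀ a b, Adj a b → Adj b a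
  closed : IsClosed {p : V × V | Adj p.1 p.2}

instance TopGraph.instTopologicalSpace (K : TopGraph.{u}) : TopologicalSpace K.V := K.top

/-- An isomorphism of topological graphs. -/
def TopGraph.Isomorphic (K : TopGraph.{u}) (L : TopGraph.{v}) : Prop :=
  ∃ e : K.V ≃ₜ L.V, ∀ x y, K.Adj x y ↔ L.Adj (e x) (e y)

section FiniteGraphs

variable {A B : FinGraph.{u}}

/-- An epimorphism: edges go to edges, and the map is onto on vertices and on edges. -/
def IsEpimorphism (f : A.V → B.V) : Prop :=
  (∀ a a', A.Adj a a' → B.Adj (f a) (f a')) ∧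
  Function.Surjective f ∧
  (∀ b b', B.Adj b b' → ∃ a a', A.Adj a a' ∧ f a = b ∧ f a' = b')

/-- A set of vertices is connected if it is not the union of two nonempty sets without any edge
between them. (Such sets are disjoint, because the edge relation is reflexive.) -/
def IsConnectedSet (S : Set A.V) : Prop :=
  ¬ ∃ P Q : Set A.V, P.Nonempty ∧ Q.Nonempty ∧ P ∪ Q = S ∧ ∀ a ∈ P, ∀ b ∈ Q, ¬ A.Adj a b

/-- The component of `S` containing `a`. -/
def component (S : Set A.V) (a : A.V) : Set A.V :=
  ⋃₀ {P : Set A.V | P ⊆ S ∧ a ∈ P ∧ IsConnectedSet P}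

/-- `C` is a component of `S`. -/
def IsComponent (S C : Set A.V) : Prop :=
  ∃ a ∈ S, C = component S a

/-- Confluence: every component of the preimage of a connected set `Q` is mapped onto `Q`. -/
def IsConfluent (f : A.V → B.V) : Prop :=
  ∀ Q : Set B.V, IsConnectedSet Q → ∀ C : Set A.V, IsComponent (f ⁻¹' Q) C → f '' C = Q

/-- `n` is the winding number of `f`: each vertex fibre has exactly `n` components. -/
def HasWindingNumber (f : A.V → B.V) (n : ℕ) : Prop :=
  ∀ b : B.V, {C : Set A.V | IsComponent (f ⁻¹' {b}) C}.ncard = n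

end FiniteGraphs

/-- A cycle: at least three vertices, cyclically enumerated without repetition, where two distinct
vertices are adjacent exactly when they are cyclically consecutive. -/
def IsCycle (A : FinGraph.{u}) : Prop :=
  ∃ n : ℕ, 3 ≤ n ∧ ∃ c : ZMod n ≃ A.V,
    ∀ i j : ZMod n, A.Adj (c i) (c j) ↔ (i = j ∨ j = i + 1 ∨ i = j + 1)

/-- A class of finite graphs with a fixed class of epimorphisms between its members. -/
structure GraphClass where
  obj : Set FinGraph.{u}
  epi : ∀ A B : FinGraph.{u}, Set (A.V → B.V)
  isEpimorphism : ∀ A ∈ obj, ∀ B ∈ obj, ∀ f ∈ epi A B, IsEpimorphism f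

namespace GraphClass

/-- `A` and `B` are isomorphic in the class `D`: there are mutually inverse maps between them that
both belong to `D`. (They are then isomorphisms of graphs.) -/
def Isomorphic (D : GraphClass.{u}) (A B : FinGraph.{u}) : Prop :=
  ∃ f ∈ D.epi A B, ∃ g ∈ D.epi B A, g ∘ f = id ∧ f ∘ g = id

/-- Projective Fraïssé classes. -/
structure IsProjectiveFraisse (D : GraphClass.{u}) : Prop where
  countable : ∀ S : Set FinGraph.{u}, S ⊆ D.obj →
    S.Pairwise (fun A B => ¬ D.Isomorphic A B) → S.Countable
  id_mem : ∀ A ∈ D.obj, id ∈ D.epi A A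
  comp_mem : ∀ A ∈ D.obj, ∀ B ∈ D.obj, ∀ C ∈ D.obj, ∀ f ∈ D.epi A B, ∀ g ∈ D.epi B C,
    g ∘ f ∈ D.epi A C
  joint : ∀ B ∈ D.obj, ∀ C ∈ D.obj, ∃ E ∈ D.obj, (D.epi E B).Nonempty ∧ (D.epi E C).Nonempty
  amalgamation : ∀ A ∈ D.obj, ∀ B ∈ D.obj, ∀ C ∈ D.obj, ∀ f ∈ D.epi B A, ∀ g ∈ D.epi C A,
    ∃ E ∈ D.obj, ∃ f₀ ∈ D.epi E B, ∃ g₀ ∈ D.epi E C, f ∘ f₀ = g ∘ g₀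

/-- A class of cycles with confluent epimorphisms (not necessarily all cycles, nor all confluent
epimorphisms between them). -/
def IsClassOfCycles (D : GraphClass.{u}) : Prop :=
  (∀ A ∈ D.obj, IsCycle A) ∧
  (∀ A ∈ D.obj, ∀ B ∈ D.obj, ∀ f ∈ D.epi A B, IsConfluent f)

/-- Every member `C` has a preimage in the class, under a map of the class, such that every
component of every vertex fibre has at least two vertices. -/
def HasThickPreimages (D : GraphClass.{u}) : Prop :=
  ∀ C ∈ D.obj, ∃ B ∈ D.obj, ∃ f ∈ D.epi B C,
    ∀ x : C.V, ∀ K : Set B.V, IsComponent (f ⁻¹' {x}) K → 2 ≤ K.ncard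

/-- The set of winding numbers of the epimorphisms of the class onto the member `C`. -/
def windingNumbersOnto (D : GraphClass.{u}) (C : FinGraph.{u}) : Set ℕ :=
  {n | ∃ B ∈ D.obj, ∃ f ∈ D.epi B C, HasWindingNumber f n}

/-- The set of winding numbers of all epimorphisms of the class. -/
def windingNumbers (D : GraphClass.{u}) : Set ℕ :=
  {n | ∃ C ∈ D.obj, n ∈ D.windingNumbersOnto C}

/-- An inverse sequence of members of the class, with bonding maps in the class. -/
structure InverseSequence (D : GraphClass.{u}) where
  F : ℕ → FinGraph.{u}
  F_mem : ∀ n, F n ∈ D.obj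
  α : ∀ n, (F (n + 1)).V → (F n).V
  α_mem : ∀ n, α n ∈ D.epi (F (n + 1)) (F n)

namespace InverseSequence

variable {D : GraphClass.{u}}

/-- The vertices of the inverse limit, with the topology of a subspace of the product. -/
abbrev Thread (S : D.InverseSequence) : Type u :=
  {x : ∀ n, (S.F n).V // ∀ n, S.α n (x (n + 1)) = x n}

theorem isClosed_threads (S : D.InverseSequence) :
    IsClosed {x : ∀ n, (S.F n).V | ∀ n, S.α n (x (n + 1)) = x n} := by
  simp only [Set.ofPred_forall]
  refine isClosed_iInter fun n => ?_
  exact isClosed_eq (continuous_of_discreteTopology.comp (continuous_apply (n + 1)))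
    (continuous_apply n)

/-- The inverse limit of an inverse sequence, as a topological graph: two threads are adjacent if
and only if all their coordinates are. -/
def limit (S : D.InverseSequence) : TopGraph.{u} where
  V := S.Thread
  top := inferInstance
  compact := isCompact_iff_compactSpace.mp S.isClosed_threads.isCompact
  t2 := inferInstance
  totallyDisconnected := inferInstance
  secondCountable := Topology.IsInducing.subtypeVal.secondCountableTopology
  Adj x y := ∀ n, (S.F n).Adj (x.1 n) (y.1 n)
  refl x n := (S.F n).refl (x.1 n)
  symm x y h n := (S.F n).symm _ _ (h n)
  closed := by
    simp only [Set.ofPred_forall]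
    refine isClosed_iInter fun n => ?_
    have hc : Continuous (fun p : S.Thread × S.Thread => (p.1.1 n, p.2.1 n)) :=
      ((continuous_apply n).comp (continuous_subtype_val.comp continuous_fst)).prodMk
        ((continuous_apply n).comp (continuous_subtype_val.comp continuous_snd))
    exact (isClosed_discrete {q : (S.F n).V × (S.F n).V | (S.F n).Adj q.1 q.2}).preimage hc

/-- The epimorphisms from the inverse limit onto a finite graph `A` that belong to the class, in
the usual extension of the fixed class of epimorphisms to inverse limits: those that factor as a
projection to some stage followed by an epimorphism of the class. -/
def IsClassEpi (S : D.InverseSequence) (A : FinGraph.{u}) (f : S.limit.V → A.V) : Prop :=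
  ∃ n, ∃ φ ∈ D.epi (S.F n) A, ∀ x : S.Thread, f x = φ (x.1 n)

/-- The three properties that characterize the projective Fraïssé limit. In the third one, the set
`U` takes the role of the set of pairs of points at distance less than `ε`. -/
structure IsLimiting (S : D.InverseSequence) : Prop where
  onto : ∀ A ∈ D.obj, ∃ f, S.IsClassEpi A f
  lifting : ∀ A ∈ D.obj, ∀ B ∈ D.obj, ∀ f, S.IsClassEpi A f → ∀ g ∈ D.epi B A,
    ∃ h, S.IsClassEpi B h ∧ f = g ∘ h
  refining : ∀ U : Set (S.limit.V × S.limit.V), IsOpen U → (∀ x, (x, x) ∈ U) →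
    ∃ A ∈ D.obj, ∃ f, S.IsClassEpi A f ∧ ∀ x y, f x = f y → (x, y) ∈ U

end InverseSequence

/-- `K` is the projective Fraïssé limit of the class `D`. -/
def IsProjectiveFraisseLimit (D : GraphClass.{u}) (K : TopGraph.{v}) : Prop :=
  ∃ S : D.InverseSequence, K.Isomorphic S.limit ∧ S.IsLimiting

end GraphClass

/-- The topological realization of `K`, which exists if the edge relation is transitive, hence an
equivalence relation: the quotient space of the space of vertices by the edge relation. -/
abbrev TopGraph.Realization (K : TopGraph.{u}) (h : ∀ a b c, K.Adj a b → K.Adj b c → K.Adj a c) :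
    Type u :=
  Quotient (⟨K.Adj, K.refl, fun {a b} => K.symm a b, fun {a b c} => h a b c⟩ : Setoid K.V)

/-- The inverse limit of the unit circles with the bonding maps `z ↦ z ^ (n i)`. -/
abbrev SolenoidSpace (n : ℕ → ℕ) : Type :=
  {z : ℕ → Circle // ∀ i, z (i + 1) ^ (n i) = z i}

/-- A solenoid: the inverse limit of circles with bonding maps `z ↦ z ^ (n i)`, `n i ≥ 1`.
The circle is included, as the trivial solenoid. -/
def IsSolenoid (X : Type u) [TopologicalSpace X] : Prop :=
  ∃ n : ℕ → ℕ, (∀ i, 1 ≤ n i) ∧ Nonempty (X ≃ₜ SolenoidSpace n)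

/-- A solenoid other than the circle: all exponents can be taken to be at least two. -/
def IsNontrivialSolenoid (X : Type u) [TopologicalSpace X] : Prop :=
  ∃ n : ℕ → ℕ, (∀ i, 2 ≤ n i) ∧ Nonempty (X ≃ₜ SolenoidSpace n)

end FraisseCycles

namespace FraisseCycles

/-! Unroll every cycle to the integers. An edge-preserving map between cycles lifts to a function on
the integers with steps of size at most one, and the lift has a signed degree. Confluence forbids
the lift to turn back (`not_turn`), so it is monotone or antitone, and reversing an enumeration
makes it monotone of positive degree. Degrees multiply under composition and bound winding numbers
from above.

In a limiting sequence, thick preimages and the lifting property give above each stage a later stage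
whose bonding map has a lift with `F (k + 2) ≤ F k + 1`. Two consecutive edges then collapse to at
most one, which makes adjacency in the limit transitive.

Along a subsequence of such stages the cycles are laid out on the line: stage `i` becomes a periodic
partition whose period is the product of the earlier degrees, and each of its intervals is cut at
stage `i + 1` into at least two equal pieces, one for each index in the block of the lift above it.
The mesh tends to zero, so a thread determines a point on every circle, and these circles cover one
another by power maps. Two threads have the same circle coordinates exactly when they are adjacent,
so the realization is the solenoid whose exponents are the degrees.

If the winding numbers onto one `C` are unbounded, a projection to `C` of fixed degree must factor
at a later stage through a map of larger degree. The bonding map in between then has degree at least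
two, and this can be repeated above every stage.

The limiting sequence itself comes from bookkeeping over countably many lifting problems. -/

/-! ### Components and cyclic enumerations -/

theorem component_subset {A : FinGraph.{u}} {S T : Set A.V} {a : A.V} (ha : a ∈ T)
    (h : ∀ x ∈ S ∩ T, ∀ y ∈ S \ T, ¬ A.Adj x y) : component S a ⊆ T := by
  rintro y ⟨P, ⟨hPS, haP, hP⟩, hyP⟩
  by_contra hy
  exact hP ⟨P ∩ T, P \ T, ⟨a, haP, ha⟩, ⟨y, hyP, hy⟩, Set.inter_union_sdiff P T,
    fun x hx z hz => h x ⟨hPS hx.1, hx.2⟩ z ⟨hPS hz.1, hz.2⟩⟩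

theorem subset_component {A : FinGraph.{u}} {S T : Set A.V} {a : A.V} (ha : a ∈ T)
    (hTS : T ⊆ S) (hT : IsConnectedSet T) : T ⊆ component S a :=
  fun _ hy => ⟨T, ⟨hTS, ha, hT⟩, hy⟩

theorem isConnectedSet_pair {A : FinGraph.{u}} {a b : A.V} (h : A.Adj a b) :
    IsConnectedSet ({a, b} : Set A.V) := by
  rintro ⟨P, Q, ⟨x, hx⟩, ⟨y, hy⟩, hPQ, hno⟩
  have hx' : x ∈ ({a, b} : Set A.V) := hPQ ▸ Or.inl hx
  have hy' : y ∈ ({a, b} : Set A.V) := hPQ ▸ Or.inr hy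
  refine hno x hx y hy ?_
  rcases hx' with rfl | rfl <;> rcases hy' with rfl | rfl
  · exact A.refl _
  · exact h
  · exact A.symm _ _ h
  · exact A.refl _

/-- An enumeration of a cycle with `n` vertices by the integers, with period `n`. -/
structure CyclicEnum (A : FinGraph.{u}) (n : ℕ) (e : ℤ → A.V) : Prop where
  three_le : 3 ≤ n
  surj : Function.Surjective e
  eq_iff : ∀ i j, e i = e j ↔ (n : ℤ) ∣ j - i
  adj_iff : ∀ i j, A.Adj (e i) (e j) ↔ ∃ l, |l - i| ≤ 1 ∧ e j = e l

theorem IsCycle.exists_cyclicEnum {A : FinGraph.{u}} (hA : IsCycle A) :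
    ∃ n e, CyclicEnum A n e := by
  obtain ⟨n, hn, c, hc⟩ := hA
  refine ⟨n, fun i => c (i : ZMod n), hn, c.surjective.comp ZMod.intCast_surjective,
    fun i j => ?_, fun i j => ?_⟩
  · rw [c.injective.eq_iff, ZMod.intCast_eq_intCast_iff_dvd_sub]
  · rw [hc]
    constructor
    · rintro (h | h | h)
      · exact ⟨i, by simp, by rw [h]⟩
      · exact ⟨i + 1, by simp, by rw [h]; push_cast; rfl⟩
      · exact ⟨i - 1, by simp, by rw [Int.cast_sub, h]; simp⟩
    · rintro ⟨l, hl, h⟩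
      have hjl : (j : ZMod n) = l := c.injective h
      rw [hjl]
      rw [abs_le] at hl
      obtain h | h | h : l = i ∨ l = i + 1 ∨ l = i - 1 := by omega
      · left; rw [h]
      · right; left; rw [h]; push_cast; rfl
      · right; right; rw [h]; push_cast; ring

namespace CyclicEnum

variable {A : FinGraph.{u}} {n : ℕ} {e : ℤ → A.V}

theorem neg (h : CyclicEnum A n e) : CyclicEnum A n (fun k => e (-k)) where
  three_le := h.three_le
  surj := h.surj.comp neg_surjective
  eq_iff i j := by
    rw [h.eq_iff, ← dvd_neg]
    congr! 1
    ring
  adj_iff i j := by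
    rw [h.adj_iff]
    constructor
    · rintro ⟨l, hl, hj⟩
      refine ⟨-l, ?_, by rw [hj, neg_neg]⟩
      rw [abs_le] at hl ⊢
      omega
    · rintro ⟨l, hl, hj⟩
      refine ⟨-l, ?_, hj⟩
      rw [abs_le] at hl ⊢
      omega

theorem add_eq_add_iff (h : CyclicEnum A n e) (i j d : ℤ) :
    e (i + d) = e (j + d) ↔ e i = e j := by
  rw [h.eq_iff, h.eq_iff, add_sub_add_right_eq_sub]

theorem eq_of_abs_sub_lt (h : CyclicEnum A n e) {i j : ℤ} (hij : e i = e j)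
    (hlt : |j - i| < n) : i = j := by
  have := Int.eq_zero_of_abs_lt_dvd ((h.eq_iff i j).1 hij) hlt
  omega

theorem adj_of_abs_le (h : CyclicEnum A n e) {i j : ℤ} (hij : |j - i| ≤ 1) :
    A.Adj (e i) (e j) :=
  (h.adj_iff i j).2 ⟨j, hij, rfl⟩

theorem add_period (h : CyclicEnum A n e) (i r : ℤ) : e (i + r * n) = e i :=
  ((h.eq_iff _ _).2 ⟨r, by ring⟩).symm

theorem exists_near (h : CyclicEnum A n e) {x : A.V} {i : ℤ} (hx : A.Adj (e i) x) :
    ∃ l, |l - i| ≤ 1 ∧ x = e l := by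
  obtain ⟨j, rfl⟩ := h.surj x
  exact (h.adj_iff i j).1 hx

end CyclicEnum

/-! ### Integer lifts of maps between cycles -/

theorem add_mul_period_of_period {F : ℤ → ℤ} {m : ℕ} {c : ℤ} (h : ∀ k, F (k + m) = F k + c)
    (k r : ℤ) : F (k + r * m) = F k + r * c := by
  induction r with
  | zero => simp
  | succ r ih =>
    rw [show k + ((r : ℤ) + 1) * m = k + r * m + m by ring, h, ih]
    ring
  | pred r ih =>
    have := h (k + (-(r : ℤ) - 1) * m)
    rw [show k + (-(r : ℤ) - 1) * m + m = k + (-(r : ℤ)) * m by ring, ih] at this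
    linarith

/-- `F` is a lift to the integers of the map `f` between cyclically enumerated graphs, and `w` is
its signed degree. -/
structure IsLift {A B : FinGraph.{u}} (m n : ℕ) (eA : ℤ → A.V) (eB : ℤ → B.V) (f : A.V → B.V)
    (F : ℤ → ℤ) (w : ℤ) : Prop where
  map : ∀ k, f (eA k) = eB (F k)
  step : ∀ k, |F (k + 1) - F k| ≤ 1
  period : ∀ k, F (k + m) = F k + w * n

/-- The difference of the two lifts is always a multiple of `n`, and it changes by at most 2 in a
step. Since `n ≥ 3`, it is constant. -/
theorem lift_sub_eq {B : FinGraph.{u}} {n : ℕ} {eB : ℤ → B.V} (hB : CyclicEnum B n eB)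
    {F G : ℤ → ℤ} (h : ∀ k, eB (F k) = eB (G k)) (hF : ∀ k, |F (k + 1) - F k| ≤ 1)
    (hG : ∀ k, |G (k + 1) - G k| ≤ 1) (k : ℤ) : G k - F k = G 0 - F 0 := by
  have key : ∀ k, G (k + 1) - F (k + 1) = G k - F k := by
    intro k
    have h1 := (hB.eq_iff _ _).1 (h k)
    have h2 := (hB.eq_iff _ _).1 (h (k + 1))
    have h3 := dvd_sub h2 h1
    have h4 := Int.eq_zero_of_abs_lt_dvd h3 (by
      have := hF k
      have := hG k
      have := hB.three_le
      rw [abs_le] at *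
      rw [abs_lt]
      omega)
    omega
  induction k with
  | zero => rfl
  | succ k ih => rw [key, ih]
  | pred k ih =>
    rw [← ih, ← key (-(k : ℤ) - 1), sub_add_cancel]

theorem exists_antidifference (d : ℤ → ℤ) (a : ℤ) :
    ∃ F : ℤ → ℤ, F 0 = a ∧ ∀ k, F (k + 1) = F k + d k := by
  refine ⟨fun k => a + ∑ i ∈ Finset.range k.toNat, d i -
    ∑ i ∈ Finset.range (-k).toNat, d (-(i + 1)), by simp, fun k => ?_⟩
  rcases le_or_gt 0 k with hk | hk
  · lift k to ℕ using hk
    have h1 : ((k : ℤ) + 1).toNat = k + 1 := by omega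
    have h2 : (-((k : ℤ) + 1)).toNat = 0 := by omega
    have h3 : (-(k : ℤ)).toNat = 0 := by omega
    simp only [h1, h2, h3, Int.toNat_natCast, Finset.sum_range_succ, Finset.range_zero,
      Finset.sum_empty]
    ring
  · obtain ⟨j, rfl⟩ : ∃ j : ℕ, k = -((j : ℤ) + 1) := ⟨(-k - 1).toNat, by omega⟩
    have h1 : (-((j : ℤ) + 1) + 1).toNat = 0 := by omega
    have h2 : (-(-((j : ℤ) + 1) + 1)).toNat = j := by omega
    have h3 : (-((j : ℤ) + 1)).toNat = 0 := by omega
    have h4 : (- -((j : ℤ) + 1)).toNat = j + 1 := by omega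
    simp only [h1, h2, h3, h4, Finset.sum_range_succ, Finset.range_zero, Finset.sum_empty]
    ring

section Lifts

variable {A B C : FinGraph.{u}} {m n p : ℕ} {eA : ℤ → A.V} {eB : ℤ → B.V} {eC : ℤ → C.V}
  {f : A.V → B.V} {g : B.V → C.V} {F G : ℤ → ℤ} {w v : ℤ}

namespace IsLift

theorem add_mul_period (h : IsLift m n eA eB f F w) (k r : ℤ) :
    F (k + r * m) = F k + r * (w * n) :=
  add_mul_period_of_period h.period k r

theorem comp (hf : IsLift m n eA eB f F w) (hg : IsLift n p eB eC g G v) :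
    IsLift m p eA eC (g ∘ f) (G ∘ F) (w * v) where
  map k := by simp [hf.map, hg.map]
  step k := by
    have h1 := hf.step k
    simp only [Function.comp]
    rw [abs_le] at h1
    obtain h | h | h : F (k + 1) = F k ∨ F (k + 1) = F k + 1 ∨ F k = F (k + 1) + 1 := by omega
    · simp [h]
    · rw [h]; exact hg.step _
    · rw [h, abs_sub_comm]; exact hg.step _
  period k := by
    simp only [Function.comp]
    rw [hf.period, hg.add_mul_period]
    ring

theorem degree_unique (hB : CyclicEnum B n eB) (hF : IsLift m n eA eB f F w)
    (hG : IsLift m n eA eB f G v) : w = v := by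
  have h := lift_sub_eq hB (fun k => (hF.map k).symm.trans (hG.map k)) hF.step hG.step (0 + m)
  rw [hF.period, hG.period] at h
  have hn : (n : ℤ) ≠ 0 := by have := hB.three_le; omega
  exact mul_right_cancel₀ hn (by linarith)

theorem neg_dom (h : IsLift m n eA eB f F w) :
    IsLift m n (fun k => eA (-k)) eB f (fun k => F (-k)) (-w) where
  map k := h.map _
  step k := by
    have := h.step (-(k + 1))
    rw [abs_sub_comm]
    convert this using 4
    ring
  period k := by
    have := h.period (-(k + m))
    rw [show -(k + (m : ℤ)) + m = -k by ring] at this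
    linarith

theorem neg_cod (h : IsLift m n eA eB f F w) :
    IsLift m n eA (fun k => eB (-k)) f (fun k => -F k) (-w) where
  map k := by simp [h.map]
  step k := by
    have := h.step k
    rw [abs_le] at *
    omega
  period k := by
    rw [h.period]
    ring

/-- Each edge of the domain determines an increment that is valid above every index of the image
vertex; summing the increments gives the lift. Shifting by `m` gives another lift of the same map,
so `lift_sub_eq` makes the gain over a period constant. -/
theorem exists_of_hom (hA : CyclicEnum A m eA) (hB : CyclicEnum B n eB)
    (hf : ∀ a a', A.Adj a a' → B.Adj (f a) (f a')) : ∃ F w, IsLift m n eA eB f F w := by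
  have h1 : ∀ k, ∃ d : ℤ, |d| ≤ 1 ∧ ∀ l, f (eA k) = eB l → f (eA (k + 1)) = eB (l + d) := by
    intro k
    obtain ⟨j, hj⟩ := hB.surj (f (eA k))
    have := hf _ _ (hA.adj_of_abs_le (i := k) (j := k + 1) (by simp))
    rw [← hj] at this
    obtain ⟨l, hl, h⟩ := hB.exists_near this
    refine ⟨l - j, hl, fun i hi => ?_⟩
    rw [h, ← add_sub_cancel j l, add_sub_cancel_left, hB.add_eq_add_iff, hj, hi]
  choose d hd hd' using h1
  obtain ⟨a, ha⟩ := hB.surj (f (eA 0))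
  obtain ⟨F, hF0, hF⟩ := exists_antidifference d a
  have hmap : ∀ k, f (eA k) = eB (F k) := by
    intro k
    induction k with
    | zero => rw [hF0, ha]
    | succ k ih => rw [hF]; exact hd' _ _ ih
    | pred k ih =>
      obtain ⟨j, hj⟩ := hB.surj (f (eA (-(k : ℤ) - 1)))
      have h2 := hd' _ _ hj.symm
      have h3 := hF (-(k : ℤ) - 1)
      rw [sub_add_cancel] at h2 h3
      rw [ih, h3, hB.add_eq_add_iff] at h2
      rw [← hj, h2]
  have hstep : ∀ k, |F (k + 1) - F k| ≤ 1 := fun k => by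
    rw [hF, add_sub_cancel_left]
    exact hd k
  have hper : ∀ k, eA (k + m) = eA k := fun k => by simpa using hA.add_period k 1
  have h4 : ∀ k, eB (F k) = eB (F (k + m)) := fun k => by rw [← hmap, ← hmap, hper]
  obtain ⟨w, hw⟩ := (hB.eq_iff _ _).1 (h4 0)
  refine ⟨F, w, hmap, hstep, fun k => ?_⟩
  have := lift_sub_eq hB h4 hstep (fun k => by
    rw [add_right_comm]
    exact hstep _) k
  rw [hw] at this
  linarith

/-- A lift of a confluent map does not turn back. -/
theorem not_turn (hA : CyclicEnum A m eA) (hB : CyclicEnum B n eB)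
    (h : IsLift m n eA eB f F w) (hf : IsConfluent f) {ε : ℤ} (hε : |ε| = 1) {a b J : ℤ}
    (hab : a < b) (ha : F a = J - ε) (hJ : ∀ i, a < i → i ≤ b → F i = J)
    (hb : F (b + 1) = J - ε) : False := by
  have hn := hB.three_le
  have hε' : ε = 1 ∨ ε = -1 := by
    rcases abs_eq (zero_le_one) |>.1 hε with h | h <;> simp [h]
  -- Confluence is tested on the edge just beyond the turning point: the plateau is a whole
  -- component over it, yet never reaches the far end.
  set Q : Set B.V := {eB J, eB (J + ε)} with hQ
  have hQc : IsConnectedSet Q := isConnectedSet_pair (hB.adj_of_abs_le (by simp [hε]))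
  have hnot : eB (J - ε) ∉ Q := by
    rintro (h | h) <;>
    · have := hB.eq_of_abs_sub_lt h (by rw [abs_lt]; omega)
      omega
  have haS : eA (a + 1) ∈ f ⁻¹' Q := by
    rw [Set.mem_preimage, h.map, hJ _ (by omega) (by omega)]
    exact Or.inl rfl
  have himg := hf Q hQc _ ⟨_, haS, rfl⟩
  have hsub : component (f ⁻¹' Q) (eA (a + 1)) ⊆ eA '' Set.Ioc a b := by
    refine component_subset ⟨a + 1, ⟨by omega, by omega⟩, rfl⟩ ?_
    rintro x ⟨-, i, ⟨hi1, hi2⟩, rfl⟩ y ⟨hyS, hyT⟩ hadj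
    obtain ⟨l, hl, rfl⟩ := hA.exists_near hadj
    have hl' : ¬ (a < l ∧ l ≤ b) := fun hl' => hyT ⟨l, hl', rfl⟩
    rw [abs_le] at hl
    have hFl : F l = J - ε := by
      obtain rfl | rfl : l = a ∨ l = b + 1 := by omega
      · exact ha
      · exact hb
    rw [Set.mem_preimage, h.map, hFl] at hyS
    exact hnot hyS
  have hmem : eB (J + ε) ∈ f '' component (f ⁻¹' Q) (eA (a + 1)) := by
    rw [himg]
    exact Or.inr rfl
  obtain ⟨x, hx, hxe⟩ := hmem
  obtain ⟨i, ⟨hi1, hi2⟩, rfl⟩ := hsub hx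
  rw [h.map, hJ i hi1 hi2] at hxe
  have := hB.eq_of_abs_sub_lt hxe (by rw [abs_lt]; omega)
  omega

/-- To the right of `k` the most recent change is always by `ε`, so `not_turn` excludes a change by
`-ε` next. Periodicity carries this to every index. -/
theorem step_nonneg (hA : CyclicEnum A m eA) (hB : CyclicEnum B n eB)
    (h : IsLift m n eA eB f F w) (hf : IsConfluent f) {ε : ℤ} (hε : |ε| = 1) {k : ℤ}
    (hk : F (k + 1) = F k + ε) (l : ℤ) : 0 ≤ ε * (F (l + 1) - F l) := by
  have hε' : ε = 1 ∨ ε = -1 := by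
    rcases abs_eq (zero_le_one) |>.1 hε with h | h <;> simp [h]
  have hback : ∀ l a, a < l → F a = F l - ε → (∀ i, a < i → i ≤ l → F i = F l) →
      F (l + 1) = F l ∨ F (l + 1) = F l + ε := by
    intro l a hal ha hi
    have h1 := h.step l
    have h2 : F (l + 1) ≠ F l - ε := fun hb => h.not_turn hA hB hf hε hal ha hi hb
    rw [abs_le] at h1
    rcases hε' with rfl | rfl <;> omega
  -- Here `a` is the last index before the current plateau, reached by a step `ε`.
  have main : ∀ j : ℕ, ∃ a, a < k + 1 + j ∧ F a = F (k + 1 + j) - ε ∧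
      ∀ i, a < i → i ≤ k + 1 + j → F i = F (k + 1 + j) := by
    intro j
    induction j with
    | zero =>
      refine ⟨k, by simp, by simp [hk], fun i h1 h2 => ?_⟩
      congr 1
      push_cast at h2 ⊢
      omega
    | succ j ih =>
      obtain ⟨a, h1, h2, h3⟩ := ih
      push_cast
      rw [← add_assoc]
      rcases hback _ _ h1 h2 h3 with h4 | h4
      · refine ⟨a, by omega, by omega, fun i h5 h6 => ?_⟩
        rcases h6.eq_or_lt with rfl | h6
        · rfl
        · rw [h4, h3 i h5 (by omega)]
      · refine ⟨k + 1 + j, by omega, by omega, fun i h5 h6 => ?_⟩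
        congr 1
        omega
  have hm : (1 : ℤ) ≤ m := by have := hA.three_le; omega
  set r : ℤ := |l| + |k| + 1 with hr
  have hrm : r ≤ r * m := le_mul_of_one_le_right (by positivity) hm
  have hlr : k + 1 ≤ l + r * m := by
    have := neg_abs_le l
    have := le_abs_self k
    omega
  obtain ⟨j, hj⟩ := Int.eq_ofNat_of_zero_le (sub_nonneg.2 hlr)
  obtain ⟨a, h1, h2, h3⟩ := main j
  have h4 := hback _ _ h1 h2 h3
  have hl : k + 1 + (j : ℤ) = l + r * m := by omega
  rw [hl, show l + r * m + 1 = l + 1 + r * m by ring, h.add_mul_period, h.add_mul_period] at h4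
  rcases hε' with rfl | rfl <;> omega

/-- A confluent epimorphism between cycles has a monotone or an antitone lift. -/
theorem exists_of_confluent (hA : CyclicEnum A m eA) (hB : CyclicEnum B n eB)
    (hf : IsEpimorphism f) (hc : IsConfluent f) :
    ∃ F w, IsLift m n eA eB f F w ∧ ((Monotone F ∧ 0 < w) ∨ (Antitone F ∧ w < 0)) := by
  obtain ⟨F, w, h⟩ := exists_of_hom hA hB hf.1
  refine ⟨F, w, h, ?_⟩
  have hm := hA.three_le
  have hn := hB.three_le
  have hne : ∃ k, F (k + 1) ≠ F k := by
    by_contra! hcon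
    have hconst : ∀ k, F k = F 0 := by
      intro k
      induction k with
      | zero => rfl
      | succ k ih => rw [hcon, ih]
      | pred k ih => rw [← ih, ← hcon (-(k : ℤ) - 1), sub_add_cancel]
    obtain ⟨x, hx⟩ := hf.2.1 (eB (F 0 + 1))
    obtain ⟨k, rfl⟩ := hA.surj x
    rw [h.map, hconst] at hx
    have := hB.eq_of_abs_sub_lt hx (by simp; omega)
    omega
  obtain ⟨k, hk⟩ := hne
  have hs := h.step k
  have hp := h.period k
  rw [abs_le] at hs
  obtain h1 | h1 : F (k + 1) = F k + 1 ∨ F (k + 1) = F k + -1 := by omega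
  · left
    have hmono : Monotone F := monotone_int_of_le_succ fun l => by
      have := h.step_nonneg hA hB hc (by simp) h1 l
      omega
    refine ⟨hmono, ?_⟩
    have := hmono (show k + 1 ≤ k + m by omega)
    by_contra! hw
    have := mul_nonpos_of_nonpos_of_nonneg hw (Int.natCast_nonneg n)
    omega
  · right
    have hanti : Antitone F := antitone_int_of_succ_le fun l => by
      have := h.step_nonneg hA hB hc (by simp) h1 l
      omega
    refine ⟨hanti, ?_⟩
    have := hanti (show k + 1 ≤ k + m by omega)
    by_contra! hw
    have := mul_nonneg hw (Int.natCast_nonneg n)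
    omega

/-- Reversing the domain flips the sign of the degree. Keeping the codomain enumeration as given
lets orientations propagate coherently up a sequence. -/
theorem exists_domain_enum (hA : IsCycle A) (hB : CyclicEnum B n eB) (hf : IsEpimorphism f)
    (hc : IsConfluent f) : ∃ m eA F w, CyclicEnum A m eA ∧ IsLift m n eA eB f F w ∧
      Monotone F ∧ 0 < w := by
  obtain ⟨m, eA, hA⟩ := hA.exists_cyclicEnum
  obtain ⟨F, w, h, ⟨h1, h2⟩ | ⟨h1, h2⟩⟩ := exists_of_confluent hA hB hf hc
  · exact ⟨m, eA, F, w, hA, h, h1, h2⟩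
  · exact ⟨m, _, _, _, hA.neg, h.neg_dom, fun a b hab => h1 (neg_le_neg hab), by omega⟩

theorem exists_codomain_enum (hA : CyclicEnum A m eA) (hB : IsCycle B) (hf : IsEpimorphism f)
    (hc : IsConfluent f) : ∃ n eB F w, CyclicEnum B n eB ∧ IsLift m n eA eB f F w ∧
      Monotone F ∧ 0 < w := by
  obtain ⟨n, eB, hB⟩ := hB.exists_cyclicEnum
  obtain ⟨F, w, h, ⟨h1, h2⟩ | ⟨h1, h2⟩⟩ := exists_of_confluent hA hB hf hc
  · exact ⟨n, eB, F, w, hB, h, h1, h2⟩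
  · exact ⟨n, _, _, _, hB.neg, h.neg_cod, fun a b hab => neg_le_neg (h1 hab), by omega⟩

/-- Otherwise both steps around `k + 1` go up by one, so neither neighbour of that vertex lies in
its fibre and the component there is a single vertex. -/
theorem le_add_one_of_thick (hA : CyclicEnum A m eA) (hB : CyclicEnum B n eB)
    (h : IsLift m n eA eB f F w)
    (hthick : ∀ x : B.V, ∀ K : Set A.V, IsComponent (f ⁻¹' {x}) K → 2 ≤ K.ncard) (k : ℤ) :
    F (k + 2) ≤ F k + 1 := by
  by_contra! hlt
  have h1 := h.step k
  have h2 := h.step (k + 1)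
  have hn := hB.three_le
  rw [add_assoc, one_add_one_eq_two] at h2
  rw [abs_le] at h1 h2
  have hK := hthick (eB (F (k + 1))) _ ⟨eA (k + 1), h.map _, rfl⟩
  have hsub : component (f ⁻¹' {eB (F (k + 1))}) (eA (k + 1)) ⊆ {eA (k + 1)} := by
    refine component_subset rfl ?_
    rintro x ⟨-, rfl⟩ y ⟨hyS, hyT⟩ hadj
    obtain ⟨l, hl, rfl⟩ := hA.exists_near hadj
    rw [Set.mem_preimage, h.map, Set.mem_singleton_iff] at hyS
    have hl' : l ≠ k + 1 := by
      rintro rfl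
      exact hyT rfl
    rw [abs_le] at hl
    obtain rfl | rfl : l = k ∨ l = k + 2 := by omega
    all_goals
      have := hB.eq_of_abs_sub_lt hyS (by rw [abs_lt]; omega)
      omega
  have := Set.ncard_le_ncard hsub (Set.finite_singleton _)
  rw [Set.ncard_singleton] at this
  omega

theorem isConnectedSet_fibre (hA : CyclicEnum A m eA) (hmono : Monotone F) (J : ℤ) :
    IsConnectedSet (eA '' {k | F k = J}) := by
  rintro ⟨P, Q, ⟨x, hx⟩, ⟨y, hy⟩, hPQ, hno⟩
  have hx' : x ∈ eA '' {k | F k = J} := hPQ ▸ Or.inl hx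
  have hy' : y ∈ eA '' {k | F k = J} := hPQ ▸ Or.inr hy
  obtain ⟨i, hi, rfl⟩ := hx'
  obtain ⟨j, hj, rfl⟩ := hy'
  have key : ∀ (P Q : Set A.V), P ∪ Q = eA '' {k | F k = J} →
      (∀ a ∈ P, ∀ b ∈ Q, ¬ A.Adj a b) → ∀ i, eA i ∈ P → F i = J → ∀ d : ℕ, F (i + d) = J →
      eA (i + d) ∈ P := by
    intro P Q hPQ hno i hi hiJ d
    induction d with
    | zero => intro _; simpa using hi
    | succ d ih =>
      intro hd
      have h1 : F (i + d) = J :=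
        le_antisymm (hd ▸ hmono (by push_cast; omega)) (hiJ ▸ hmono (by omega))
      have h2 : eA (i + (d + 1 : ℕ)) ∈ P ∪ Q := hPQ ▸ ⟨_, hd, rfl⟩
      refine h2.resolve_right fun hQ => hno _ (ih h1) _ hQ (hA.adj_of_abs_le ?_)
      push_cast
      rw [show i + ((d : ℤ) + 1) - (i + d) = 1 by ring]
      simp
  have hdisj : ∀ z ∈ P, z ∉ Q := fun z hz hz' => hno z hz z hz' (A.refl z)
  rcases le_total i j with hij | hij
  · obtain ⟨d, rfl⟩ := Int.le.dest hij
    exact hdisj _ (key P Q hPQ hno i hx hi d hj) hy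
  · obtain ⟨d, rfl⟩ := Int.le.dest hij
    exact hdisj _ hx (key Q P (Set.union_comm P Q ▸ hPQ)
      (fun a ha b hb hab => hno b hb a ha (A.symm _ _ hab)) j hy hj d hi)

theorem component_fibre (hA : CyclicEnum A m eA) (hB : CyclicEnum B n eB)
    (h : IsLift m n eA eB f F w) (hmono : Monotone F) (k : ℤ) :
    component (f ⁻¹' {eB (F k)}) (eA k) = eA '' {l | F l = F k} := by
  refine Set.Subset.antisymm (component_subset ⟨k, rfl, rfl⟩ ?_)
    (subset_component ⟨k, rfl, rfl⟩ ?_ (isConnectedSet_fibre hA hmono _))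
  · rintro x ⟨-, i, hi, rfl⟩ y ⟨hyS, hyT⟩ hadj
    obtain ⟨l, hl, rfl⟩ := hA.exists_near hadj
    rw [Set.mem_preimage, h.map, Set.mem_singleton_iff] at hyS
    refine hyT ⟨l, hB.eq_of_abs_sub_lt hyS ?_, rfl⟩
    have hn := hB.three_le
    have hi' : F i = F k := hi
    rw [abs_le] at hl
    rw [abs_lt]
    obtain rfl | rfl | hl' : l = i ∨ l = i + 1 ∨ i = l + 1 := by omega
    · omega
    · have := h.step i
      rw [abs_le] at this
      omega
    · have := h.step l
      rw [← hl', abs_le] at this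
      omega
  · rintro _ ⟨l, hl, rfl⟩
    rw [Set.mem_preimage, h.map, show F l = F k from hl]
    rfl

/-- A component over `eB 0` is the image of a level set of `F` at some `t * n`. Translation by a
period of the domain changes `t` by `w`, so residues modulo `w` account for all components. -/
theorem windingNumber_le (hA : CyclicEnum A m eA) (hB : CyclicEnum B n eB)
    (h : IsLift m n eA eB f F w) (hmono : Monotone F) (hw : 0 < w) {W : ℕ}
    (hW : HasWindingNumber f W) : (W : ℤ) ≤ w := by
  have hn := hB.three_le
  have hsub : {K : Set A.V | IsComponent (f ⁻¹' {eB 0}) K} ⊆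
      (fun t : ℤ => eA '' {l | F l = t * n}) '' (Finset.Ico 0 w : Finset ℤ) := by
    rintro K ⟨a, ha, rfl⟩
    obtain ⟨k, rfl⟩ := hA.surj a
    rw [Set.mem_preimage, h.map, Set.mem_singleton_iff] at ha
    obtain ⟨t, ht⟩ := (hB.eq_iff _ _).1 ha.symm
    rw [sub_zero] at ht
    refine ⟨t % w, by simpa using ⟨Int.emod_nonneg _ hw.ne', Int.emod_lt_of_pos _ hw⟩, ?_⟩
    have h1 : F (k + -(t / w) * m) = t % w * n := by
      rw [h.add_mul_period, ht, Int.emod_def]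
      ring
    have h2 := h.component_fibre hA hB hmono (k + -(t / w) * m)
    rw [hA.add_period, h1] at h2
    have h3 : eB (t % w * n) = eB 0 := by simpa using hB.add_period 0 (t % w)
    rw [h3] at h2
    exact h2.symm
  have := Set.ncard_le_ncard hsub ((Finset.finite_toSet _).image _)
  rw [hW (eB 0)] at this
  have h3 := this.trans (Set.ncard_image_le (Finset.finite_toSet _))
  rw [Set.ncard_coe_finset, Int.card_Ico] at h3
  omega

end IsLift
end Lifts

open Set

/-! ### Existence of the projective Fraïssé limit -/

namespace GraphClass

variable {D : GraphClass.{u}}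

namespace IsProjectiveFraisse

/-- A projective Fraïssé class has a countable set of representatives up to isomorphism. -/
theorem exists_countable_representatives (hD : D.IsProjectiveFraisse) :
    ∃ R ⊆ D.obj, R.Countable ∧ ∀ A ∈ D.obj, ∃ A' ∈ R, D.Isomorphic A A' := by
  let s : Setoid D.obj :=
    { r := fun A B => D.Isomorphic A.1 B.1
      iseqv :=
        { refl := fun A => ⟨id, hD.id_mem _ A.2, id, hD.id_mem _ A.2, rfl, rfl⟩
          symm := fun ⟨f, hf, g, hg, h1, h2⟩ => ⟨g, hg, f, hf, h2, h1⟩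
          trans := by
            rintro A B C ⟨f, hf, g, hg, h1, h2⟩ ⟨f', hf', g', hg', h1', h2'⟩
            refine ⟨f' ∘ f, hD.comp_mem _ A.2 _ B.2 _ C.2 _ hf _ hf', g ∘ g',
              hD.comp_mem _ C.2 _ B.2 _ A.2 _ hg' _ hg, ?_, ?_⟩
            · rw [Function.comp_assoc, ← Function.comp_assoc g' f' f, h1', Function.id_comp, h1]
            · rw [Function.comp_assoc, ← Function.comp_assoc f g g', h2, Function.id_comp, h2'] } }
  refine ⟨range fun q : Quotient s => q.out.1, ?_, ?_, ?_⟩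
  · rintro _ ⟨q, rfl⟩
    exact q.out.2
  · refine hD.countable _ ?_ ?_
    · rintro _ ⟨q, rfl⟩
      exact q.out.2
    · rintro _ ⟨q, rfl⟩ _ ⟨q', rfl⟩ hne hiso
      refine hne ?_
      have h : s q.out q'.out := hiso
      have h2 : q = q' := by
        rw [← q.out_eq, ← q'.out_eq]
        exact Quotient.sound h
      simp only [h2]
  · intro A hA
    refine ⟨_, ⟨Quotient.mk s ⟨A, hA⟩, rfl⟩, ?_⟩
    exact s.symm (Quotient.mk_out (s := s) ⟨A, hA⟩)

/-- A common extension that solves the lifting problem along `g` for all maps out of `F`. -/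
theorem exists_extension (hD : D.IsProjectiveFraisse) {F A B : FinGraph.{u}} (hF : F ∈ D.obj)
    (hA : A ∈ D.obj) (hB : B ∈ D.obj) {g : B.V → A.V} (hg : g ∈ D.epi B A) :
    ∃ E ∈ D.obj, ∃ α ∈ D.epi E F, (D.epi E A).Nonempty ∧
      ∀ φ ∈ D.epi F A, ∃ ψ ∈ D.epi E B, φ ∘ α = g ∘ ψ := by
  -- There are finitely many maps `φ`, so they can be amalgamated one at a time; earlier solutions
  -- survive by precomposition.
  have key : ∃ E ∈ D.obj, ∃ α ∈ D.epi E F, ∀ φ ∈ D.epi F A, ∃ ψ ∈ D.epi E B, φ ∘ α = g ∘ ψ := by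
    refine (toFinite (D.epi F A)).induction_on_subset _ ⟨F, hF, id, hD.id_mem _ hF, by simp⟩ ?_
    rintro φ T hφ - - ⟨E, hE, α, hα, h⟩
    obtain ⟨E', hE', β, hβ, γ, hγ, hcomm⟩ := hD.amalgamation A hA E hE B hB (φ ∘ α)
      (hD.comp_mem _ hE _ hF _ hA _ hα _ hφ) g hg
    refine ⟨E', hE', α ∘ β, hD.comp_mem _ hE' _ hE _ hF _ hβ _ hα, ?_⟩
    rintro φ' (rfl | hφ')
    · exact ⟨γ, hγ, hcomm⟩
    · obtain ⟨ψ, hψ, h2⟩ := h φ' hφ'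
      refine ⟨ψ ∘ β, hD.comp_mem _ hE' _ hE _ hB _ hβ _ hψ, ?_⟩
      rw [← Function.comp_assoc, h2, Function.comp_assoc]
  obtain ⟨E, hE, α, hα, h⟩ := key
  obtain ⟨E', hE', ⟨β, hβ⟩, hne⟩ := hD.joint E hE A hA
  refine ⟨E', hE', α ∘ β, hD.comp_mem _ hE' _ hE _ hF _ hβ _ hα, hne, fun φ hφ => ?_⟩
  obtain ⟨ψ, hψ, h2⟩ := h φ hφ
  refine ⟨ψ ∘ β, hD.comp_mem _ hE' _ hE _ hB _ hβ _ hψ, ?_⟩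
  rw [← Function.comp_assoc, h2, Function.comp_assoc]

end IsProjectiveFraisse

namespace InverseSequence

/-- The composite bonding map from stage `m` to stage `n`. -/
def bond (S : D.InverseSequence) (n : ℕ) {m : ℕ} (h : n ≤ m) : (S.F m).V → (S.F n).V :=
  Nat.leRec (motive := fun m _ => (S.F m).V → (S.F n).V) id (fun m _ r x => r (S.α m x)) h

variable (S : D.InverseSequence)

@[simp]
theorem bond_self (n : ℕ) : S.bond n le_rfl = id := by
  simp [bond, Nat.leRec_self]

theorem bond_succ {n m : ℕ} (h : n ≤ m) :
    S.bond n (h.trans m.le_succ) = S.bond n h ∘ S.α m := by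
  unfold bond
  rw [Nat.leRec_succ]
  rfl

theorem bond_comp {n m k : ℕ} (h : n ≤ m) (h' : m ≤ k) :
    S.bond n h ∘ S.bond m h' = S.bond n (h.trans h') := by
  induction k, h' using Nat.le_induction with
  | base => simp
  | succ k h' ih => rw [S.bond_succ h', S.bond_succ (h.trans h'), ← ih, Function.comp_assoc]

theorem bond_thread (x : S.Thread) {n m : ℕ} (h : n ≤ m) : S.bond n h (x.1 m) = x.1 n := by
  induction m, h using Nat.le_induction with
  | base => simp
  | succ m h ih => rw [S.bond_succ h, Function.comp_apply, x.2, ih]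

theorem bond_mem (hD : D.IsProjectiveFraisse) {n m : ℕ} (h : n ≤ m) :
    S.bond n h ∈ D.epi (S.F m) (S.F n) := by
  induction m, h using Nat.le_induction with
  | base =>
    rw [bond_self]
    exact hD.id_mem _ (S.F_mem n)
  | succ m h ih =>
    rw [S.bond_succ h]
    exact hD.comp_mem _ (S.F_mem _) _ (S.F_mem _) _ (S.F_mem _) _ (S.α_mem m) _ ih

/-- A compatible family along a cofinal sequence of stages extends to a thread. -/
theorem exists_thread_of_cofinal {σ : ℕ → ℕ} (hσ : StrictMono σ) (y : ∀ i, (S.F (σ i)).V)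
    (hy : ∀ i, S.bond (σ i) (hσ.monotone i.le_succ) (y (i + 1)) = y i) :
    ∃ x : S.Thread, ∀ i, x.1 (σ i) = y i := by
  have hy' : ∀ i j (h : i ≤ j), S.bond (σ i) (hσ.monotone h) (y j) = y i := by
    intro i j h
    induction j, h using Nat.le_induction with
    | base => simp
    | succ j h ih =>
      rw [← S.bond_comp (hσ.monotone h) (hσ.monotone j.le_succ), Function.comp_apply, hy, ih]
  refine ⟨⟨fun n => S.bond n (hσ.le_apply) (y n), fun n => ?_⟩, fun i => ?_⟩
  · have h1 := S.bond_comp (n.le_succ) (hσ.le_apply (x := n + 1))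
    have h2 : S.bond n n.le_succ = S.α n := by
      rw [S.bond_succ le_rfl]
      simp
    rw [← h2, ← Function.comp_apply (f := S.bond n _), h1,
      ← S.bond_comp (hσ.le_apply (x := n)) (hσ.monotone n.le_succ), Function.comp_apply, hy]
  · exact hy' i (σ i) hσ.le_apply

theorem exists_thread (n : ℕ) (v : (S.F n).V) : ∃ x : S.Thread, x.1 n = v := by
  have hs : ∀ m, Function.Surjective (S.α m) := fun m =>
    (D.isEpimorphism _ (S.F_mem _) _ (S.F_mem _) _ (S.α_mem m)).2.1
  choose r hr using hs
  let y : ∀ i, (S.F (n + i)).V := fun i =>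
    Nat.rec (motive := fun i => (S.F (n + i)).V) v (fun i z => r (n + i) z) i
  have hσ : StrictMono (fun i => n + i) := fun a b h => by
    simpa using h
  obtain ⟨x, hx⟩ := S.exists_thread_of_cofinal hσ y (fun i => by
    have h := S.bond_succ (le_refl (n + i))
    simp only [bond_self, Function.id_comp] at h
    exact (congrFun h _).trans (hr (n + i) (y i)))
  exact ⟨x, hx 0⟩

/-- Pairs outside `U` that agree at stage `n` form a decreasing sequence of compact sets. A pair
common to all of them would lie on the diagonal, hence in `U`. -/
theorem exists_stage_subset {U : Set (S.limit.V × S.limit.V)} (hU : IsOpen U)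
    (hdiag : ∀ x, (x, x) ∈ U) :
    ∃ n, ∀ x y : S.Thread, x.1 n = y.1 n → (x, y) ∈ U := by
  have : CompactSpace S.Thread := S.limit.compact
  let Z : ℕ → Set (S.Thread × S.Thread) := fun n => {p | p.1.1 n = p.2.1 n} \ U
  have hclosed : ∀ n, IsClosed {p : S.Thread × S.Thread | p.1.1 n = p.2.1 n} := fun n =>
    isClosed_eq ((continuous_apply n).comp (continuous_subtype_val.comp continuous_fst))
      ((continuous_apply n).comp (continuous_subtype_val.comp continuous_snd))
  have hZc : ∀ n, IsClosed (Z n) := fun n => (hclosed n).sdiff hU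
  by_contra! hcon
  have hne : (⋂ n, Z n).Nonempty := by
    refine IsCompact.nonempty_iInter_of_sequence_nonempty_isCompact_isClosed Z (fun n => ?_)
      (fun n => ?_) (hZc 0).isCompact hZc
    · rintro ⟨x, y⟩ ⟨hxy, h2⟩
      refine ⟨?_, h2⟩
      have h3 : x.1 (n + 1) = y.1 (n + 1) := hxy
      change x.1 n = y.1 n
      rw [← x.2, ← y.2, h3]
    · obtain ⟨x, y, h, h'⟩ := hcon n
      exact ⟨(x, y), h, h'⟩
  obtain ⟨⟨x, y⟩, hxy⟩ := hne
  rw [mem_iInter] at hxy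
  have : x = y := Subtype.ext (funext fun n => (hxy n).1)
  subst this
  exact (hxy 0).2 (hdiag x)

end InverseSequence

/-- Only lifting problems between representatives need treatment, and they are countably many. Stage
`s` treats the problem coded by the first component of `Nat.unpair s`, so each problem recurs at
arbitrarily late stages. -/
theorem exists_isLimiting (hD : D.IsProjectiveFraisse) (hne : D.obj.Nonempty) :
    ∃ S : D.InverseSequence, S.IsLimiting := by
  obtain ⟨R, hR, hRc, hrep⟩ := hD.exists_countable_representatives
  have : Countable R := hRc.to_subtype
  let T := Σ p : R × R, {g : p.2.1.V → p.1.1.V // g ∈ D.epi p.2.1 p.1.1}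
  obtain ⟨A₀, hA₀⟩ := hne
  obtain ⟨A₁, hA₁, -⟩ := hrep A₀ hA₀
  have : Nonempty T := ⟨⟨(⟨A₁, hA₁⟩, ⟨A₁, hA₁⟩), id, hD.id_mem _ (hR hA₁)⟩⟩
  obtain ⟨τ, hτ⟩ := exists_surjective_nat T
  have hstep : ∀ (F : D.obj) (t : T), ∃ E : D.obj, ∃ α ∈ D.epi E.1 F.1,
      (D.epi E.1 t.1.1.1).Nonempty ∧ ∀ φ ∈ D.epi F.1 t.1.1.1, ∃ ψ ∈ D.epi E.1 t.1.2.1,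
        φ ∘ α = t.2.1 ∘ ψ := by
    intro F t
    obtain ⟨E, hE, h⟩ := hD.exists_extension F.2 (hR t.1.1.2) (hR t.1.2.2) t.2.2
    exact ⟨⟨E, hE⟩, h⟩
  choose next α hα honto hlift using hstep
  let F : ℕ → D.obj := fun n =>
    Nat.rec ⟨A₀, hA₀⟩ (fun n E => next E (τ (Nat.unpair n).1)) n
  let S : D.InverseSequence :=
    { F := fun n => (F n).1
      F_mem := fun n => (F n).2
      α := fun n => α (F n) (τ (Nat.unpair n).1)
      α_mem := fun n => hα _ _ }
  have task : ∀ (t : T) (n : ℕ), ∃ s ≥ n, (D.epi (S.F (s + 1)) t.1.1.1).Nonempty ∧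
      ∀ φ ∈ D.epi (S.F s) t.1.1.1, ∃ ψ ∈ D.epi (S.F (s + 1)) t.1.2.1,
        φ ∘ S.α s = t.2.1 ∘ ψ := by
    intro t n
    obtain ⟨k, rfl⟩ := hτ t
    refine ⟨Nat.pair k n, Nat.right_le_pair k n, ?_⟩
    have h1 := honto (F (Nat.pair k n)) (τ (Nat.unpair (Nat.pair k n)).1)
    have h2 := hlift (F (Nat.pair k n)) (τ (Nat.unpair (Nat.pair k n)).1)
    have h3 : τ (Nat.unpair (Nat.pair k n)).1 = τ k := by rw [Nat.unpair_pair]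
    refine ⟨h3 ▸ h1, ?_⟩
    rw [← h3]
    exact h2
  refine ⟨S, ?_, ?_, ?_⟩
  · intro A hA
    obtain ⟨A', hA', i, hi, j, hj, -, -⟩ := hrep A hA
    obtain ⟨s, -, ⟨φ, hφ⟩, -⟩ :=
      task ⟨(⟨A', hA'⟩, ⟨A', hA'⟩), id, hD.id_mem _ (hR hA')⟩ 0
    exact ⟨fun x => j (φ (x.1 (s + 1))), s + 1, j ∘ φ,
      hD.comp_mem _ (S.F_mem _) _ (hR hA') _ hA _ hφ _ hj, fun x => rfl⟩
  · rintro A hA B hB f ⟨n, φ, hφ, hf⟩ g hg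
    obtain ⟨A', hA', i, hi, j, hj, hji, -⟩ := hrep A hA
    obtain ⟨B', hB', i', hi', j', hj', -, -⟩ := hrep B hB
    have hgj := hD.comp_mem _ (hR hB') _ hB _ hA _ hj' _ hg
    -- The problem for `g` is transported to the representatives by `i` and `j'`; afterwards `j`
    -- cancels `i`.
    obtain ⟨s, hs, -, h⟩ := task ⟨(⟨A', hA'⟩, ⟨B', hB'⟩), i ∘ (g ∘ j'),
      hD.comp_mem _ (hR hB') _ hA _ (hR hA') _ hgj _ hi⟩ n
    have hφs := hD.comp_mem _ (S.F_mem _) _ (S.F_mem _) _ hA _ (S.bond_mem hD hs) _ hφ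
    obtain ⟨ψ, hψ, hcomm⟩ := h (i ∘ (φ ∘ S.bond n hs))
      (hD.comp_mem _ (S.F_mem _) _ hA _ (hR hA') _ hφs _ hi)
    refine ⟨fun x => j' (ψ (x.1 (s + 1))), ⟨s + 1, j' ∘ ψ,
      hD.comp_mem _ (S.F_mem _) _ (hR hB') _ hB _ hψ _ hj', fun x => rfl⟩, funext fun x => ?_⟩
    have h1 := congrArg j (congrFun hcomm (x.1 (s + 1)))
    have h2 : ∀ a, j (i a) = a := congrFun hji
    simp only [Function.comp_apply] at h1
    rw [h2, h2] at h1
    change f x = g (j' (ψ (x.1 (s + 1))))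
    rw [← h1]
    refine (hf x).trans ?_
    exact congrArg φ ((congrArg _ (Subtype.prop x s)).trans (S.bond_thread x hs)).symm
  · intro U hU hdiag
    obtain ⟨n, hn⟩ := S.exists_stage_subset hU hdiag
    exact ⟨S.F n, S.F_mem n, fun x => x.1 n, ⟨n, id, hD.id_mem _ (S.F_mem n), fun _ => rfl⟩, hn⟩

theorem exists_isProjectiveFraisseLimit (hD : D.IsProjectiveFraisse) (hne : D.obj.Nonempty) :
    ∃ K : TopGraph.{u}, D.IsProjectiveFraisseLimit K := by
  obtain ⟨S, hS⟩ := exists_isLimiting hD hne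
  exact ⟨S.limit, S, ⟨Homeomorph.refl _, fun _ _ => Iff.rfl⟩, hS⟩

end GraphClass

/-! ### Subdivisions of the line and covering maps of circles -/

open Filter Topology

theorem add_mul_period_real {g : ℤ → ℝ} {m : ℕ} {c : ℝ} (h : ∀ k, g (k + m) = g k + c)
    (k r : ℤ) : g (k + r * m) = g k + r * c := by
  induction r with
  | zero => simp
  | succ r ih =>
    rw [show k + ((r : ℤ) + 1) * m = k + r * m + m by ring, h, ih]
    push_cast
    ring
  | pred r ih =>
    have := h (k + (-(r : ℤ) - 1) * m)
    rw [show k + (-(r : ℤ) - 1) * m + m = k + (-(r : ℤ)) * m by ring, ih] at this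
    push_cast at this ⊢
    linarith

/-- A positive gain per period makes `F` unbounded in both directions, so a least index with `j ≤ F
k` exists. It is where the block of indices over `j` starts. -/
theorem exists_lower_adjoint {F : ℤ → ℤ} (hmono : Monotone F) {m : ℕ} {c : ℤ} (hc : 0 < c)
    (h : ∀ k, F (k + m) = F k + c) : ∃ s : ℤ → ℤ, ∀ j k, s j ≤ k ↔ j ≤ F k := by
  have key : ∀ j, ∃ a, ∀ k, a ≤ k ↔ j ≤ F k := by
    intro j
    have h1 := add_mul_period_of_period h 0 (|j - F 0|)
    have h2 := add_mul_period_of_period h 0 (-(|j - F 0| + 1))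
    rw [zero_add] at h1 h2
    have h3 : |j - F 0| ≤ |j - F 0| * c := le_mul_of_one_le_right (abs_nonneg _) hc
    have h4 : |j - F 0| + 1 ≤ (|j - F 0| + 1) * c :=
      le_mul_of_one_le_right (by positivity) hc
    have h5 := le_abs_self (j - F 0)
    have h6 := neg_abs_le (j - F 0)
    obtain ⟨a, ha, hmin⟩ := Int.exists_least_of_bdd (P := fun k => j ≤ F k)
      ⟨-(|j - F 0| + 1) * m, fun z hz => by
        by_contra! hlt
        have := hmono hlt.le
        have := neg_mul (|j - F 0| + 1) c
        omega⟩
      ⟨|j - F 0| * m, by rw [h1]; omega⟩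
    exact ⟨a, fun k => ⟨fun hk => ha.trans (hmono hk), hmin k⟩⟩
  choose s hs using key
  exact ⟨s, hs⟩

/-- Subdivision of the points `g` on the line along a periodic monotone map `F` whose fibres have
at least two elements. -/
theorem exists_subdivision {F : ℤ → ℤ} {m n w : ℕ} (hmono : Monotone F)
    (hstep : ∀ k, F (k + 1) ≤ F k + 1) (hthick : ∀ k, F (k + 2) ≤ F k + 1)
    (hper : ∀ k, F (k + m) = F k + w * n) (hw : 0 < w) (hn : 0 < n) {g : ℤ → ℝ} {L ε : ℝ}
    (hg : StrictMono g) (hgper : ∀ k, g (k + n) = g k + L) (hmesh : ∀ k, g (k + 1) - g k ≤ ε) :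
    ∃ g' : ℤ → ℝ, StrictMono g' ∧ (∀ k, g' (k + m) = g' k + w * L) ∧
      (∀ k, g' (k + 1) - g' k ≤ ε / 2) ∧ ∀ k, g (F k) ≤ g' k ∧ g' (k + 1) ≤ g (F k + 1) := by
  have hc : (0 : ℤ) < w * n := by positivity
  obtain ⟨s, hs⟩ := exists_lower_adjoint hmono hc hper
  have hsle : ∀ k, s (F k) ≤ k := fun k => (hs _ _).2 le_rfl
  have hslt : ∀ k, k < s (F k + 1) := fun k => by
    by_contra! h
    have := (hs _ _).1 h
    omega
  -- A shorter block would let `F` climb from below `j` to at least `j + 1` within two steps.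
  have hlen : ∀ j, s j + 2 ≤ s (j + 1) := by
    intro j
    by_contra! h
    have h1 := (hs (j + 1) (s j + 1)).1 (by omega)
    have h2 : ¬ j ≤ F (s j - 1) := fun h2 => by
      have := (hs _ _).2 h2
      omega
    have h3 := hthick (s j - 1)
    rw [show s j - 1 + 2 = s j + 1 by ring] at h3
    omega
  have hsper : ∀ j, s (j + w * n) = s j + m := by
    intro j
    refine eq_of_forall_ge_iff fun k => ?_
    rw [hs, show (s j + m ≤ k) ↔ s j ≤ k - m by omega, hs]
    have := hper (k - m)
    rw [sub_add_cancel] at this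
    omega
  have hlenR : ∀ j, (2 : ℝ) ≤ s (j + 1) - s j := fun j => by
    have : (s j : ℝ) + 2 ≤ s (j + 1) := by exact_mod_cast hlen j
    linarith
  have hgap : ∀ j, 0 < g (j + 1) - g j := fun j => sub_pos.2 (hg (by omega))
  -- The interval over `j` is cut into as many equal pieces as its block has indices. There are at
  -- least two, which halves the mesh.
  let δ : ℤ → ℝ := fun j => (g (j + 1) - g j) / (s (j + 1) - s j)
  have hδpos : ∀ j, 0 < δ j := fun j => div_pos (hgap j) (by linarith [hlenR j])
  have hδmul : ∀ j, δ j * (s (j + 1) - s j) = g (j + 1) - g j := fun j =>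
    div_mul_cancel₀ _ (by linarith [hlenR j])
  let g' : ℤ → ℝ := fun k => g (F k) + (k - s (F k)) * δ (F k)
  have hsucc : ∀ k, g' (k + 1) = g' k + δ (F k) := by
    intro k
    have h1 := hmono (show k ≤ k + 1 by omega)
    obtain h | h : F (k + 1) = F k ∨ F (k + 1) = F k + 1 := by have := hstep k; omega
    · simp only [g', h]
      push_cast
      ring
    · have h2 : s (F k + 1) = k + 1 :=
        le_antisymm ((hs _ _).2 (by omega)) (by have := hslt k; omega)
      have h3 := hδmul (F k)
      rw [h2] at h3
      simp only [g', h, h2]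
      push_cast at h3 ⊢
      linarith
  have hle : ∀ k, g (F k) ≤ g' k := fun k => by
    have h1 : (s (F k) : ℝ) ≤ k := by exact_mod_cast hsle k
    have := mul_nonneg (sub_nonneg.2 h1) (hδpos (F k)).le
    simp only [g']
    linarith
  refine ⟨g', strictMono_int_of_lt_succ fun k => by rw [hsucc]; linarith [hδpos (F k)],
    fun k => ?_, fun k => ?_, fun k => ⟨hle k, ?_⟩⟩
  · have hgw : ∀ k, g (k + w * n) = g k + w * L := fun k => by
      simpa using add_mul_period_real hgper k w
    simp only [g', δ, hper, hsper, hgw, add_right_comm _ ((w : ℤ) * n) 1]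
    push_cast
    ring
  · rw [hsucc, add_sub_cancel_left, div_le_div_iff₀ (by linarith [hlenR (F k)]) two_pos]
    have h1 := hmesh (F k)
    have h2 := hlenR (F k)
    have h3 := hgap (F k)
    nlinarith
  · rw [hsucc]
    have h1 : ((k : ℝ) + 1) ≤ s (F k + 1) := by exact_mod_cast hslt k
    have h2 := hδmul (F k)
    have h3 := mul_le_mul_of_nonneg_right h1 (hδpos (F k)).le
    simp only [g']
    linarith

/-- A sequence of maps of the line onto itself that lift monotone maps of cycles whose vertex
fibres have components with at least two vertices. -/
structure IsMonotoneTower (N w : ℕ → ℕ) (F : ℕ → ℤ → ℤ) : Prop where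
  pos : ∀ i, 0 < N i
  degree_pos : ∀ i, 1 ≤ w i
  mono : ∀ i, Monotone (F i)
  step : ∀ i k, F i (k + 1) ≤ F i k + 1
  thick : ∀ i k, F i (k + 2) ≤ F i k + 1
  period : ∀ i k, F i (k + N (i + 1)) = F i k + w i * N i

/-- The circumference of the `i`-th circle. -/
def circumference (w : ℕ → ℕ) (i : ℕ) : ℝ := ∏ j ∈ Finset.range i, (w j : ℝ)

/-- The covering map from the line onto the circle of length `circumference w i`. -/
noncomputable def wrap (w : ℕ → ℕ) (i : ℕ) (t : ℝ) : Circle :=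
  Circle.exp (t / circumference w i * (2 * Real.pi))

theorem circumference_succ (w : ℕ → ℕ) (i : ℕ) :
    circumference w (i + 1) = w i * circumference w i := by
  rw [circumference, Finset.prod_range_succ, mul_comm]
  rfl

theorem exists_circumference_eq_mul (w : ℕ → ℕ) {i j : ℕ} (h : i ≤ j) :
    ∃ c : ℤ, circumference w j = c * circumference w i := by
  induction j, h using Nat.le_induction with
  | base => exact ⟨1, by simp⟩
  | succ j h ih =>
    obtain ⟨c, hc⟩ := ih
    refine ⟨w j * c, ?_⟩
    rw [circumference_succ, hc]
    push_cast
    ring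

theorem continuous_wrap (w : ℕ → ℕ) (i : ℕ) : Continuous (wrap w i) :=
  Circle.exp.continuous.comp (by fun_prop)

theorem one_le_circumference {w : ℕ → ℕ} (hw : ∀ i, 1 ≤ w i) (i : ℕ) : 1 ≤ circumference w i := by
  induction i with
  | zero => simp [circumference]
  | succ i ih =>
    rw [circumference_succ]
    have : (1 : ℝ) ≤ w i := by exact_mod_cast hw i
    nlinarith

theorem wrap_eq_iff {w : ℕ → ℕ} (hw : ∀ i, 1 ≤ w i) (i : ℕ) (s t : ℝ) :
    wrap w i s = wrap w i t ↔ ∃ r : ℤ, s = t + r * circumference w i := by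
  have h1 := one_le_circumference hw i
  have h2 := Real.pi_pos
  rw [wrap, wrap, Circle.exp_eq_exp]
  refine exists_congr fun r => ?_
  rw [← add_mul, mul_left_inj' (by positivity)]
  field_simp

theorem wrap_add_mul {w : ℕ → ℕ} (hw : ∀ i, 1 ≤ w i) {i j : ℕ} (h : i ≤ j) (t : ℝ) (r : ℤ) :
    wrap w i (t + r * circumference w j) = wrap w i t := by
  obtain ⟨c, hc⟩ := exists_circumference_eq_mul w h
  rw [wrap_eq_iff hw]
  refine ⟨r * c, ?_⟩
  rw [hc]
  push_cast
  ring

/-- Both circles are quotients of the same line, one `w i` times as long as the other, so the power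
map is induced by the identity of the line. -/
theorem wrap_pow {w : ℕ → ℕ} (hw : ∀ i, 1 ≤ w i) (i : ℕ) (t : ℝ) : wrap w (i + 1) t ^ w i = wrap w i t := by
  have h1 := one_le_circumference hw i
  have h2 : (w i : ℝ) ≠ 0 := by
    have := hw i
    positivity
  rw [wrap, wrap, circumference_succ, ← Circle.exp_natCast_mul]
  congr 1
  field_simp

theorem wrap_surjective {w : ℕ → ℕ} (hw : ∀ i, 1 ≤ w i) (i : ℕ) : Function.Surjective (wrap w i) := by
  intro z
  obtain ⟨t, rfl⟩ := Circle.exp_surjective z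
  have h1 := one_le_circumference hw i
  have h2 := Real.pi_pos
  refine ⟨t / (2 * Real.pi) * circumference w i, ?_⟩
  rw [wrap]
  congr 1
  field_simp

theorem dist_wrap_le {w : ℕ → ℕ} (hw : ∀ i, 1 ≤ w i) (i : ℕ) (s t : ℝ) :
    dist (wrap w i s) (wrap w i t) ≤ |s - t| * (2 * Real.pi) := by
  have h1 := one_le_circumference hw i
  have h2 := Real.pi_pos
  have key : ∀ a b : ℝ, dist (Circle.exp a) (Circle.exp b) ≤ |a - b| := by
    intro a b
    have h3 : Circle.exp a = Circle.exp b * Circle.exp (a - b) := by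
      rw [← Circle.exp_add]
      congr 1
      ring
    have h4 := Real.norm_exp_I_mul_ofReal_sub_one_le (x := a - b)
    change dist (Circle.exp a : ℂ) (Circle.exp b : ℂ) ≤ _
    rw [Complex.dist_eq, h3, Circle.coe_mul, ← mul_sub_one, norm_mul,
      Circle.norm_coe, one_mul, Circle.coe_exp, mul_comm]
    exact h4
  refine (key _ _).trans ?_
  rw [← sub_mul, abs_mul, abs_of_pos (show 0 < 2 * Real.pi by positivity), ← sub_div, abs_div,
    abs_of_pos (show 0 < circumference w i by linarith)]
  gcongr
  exact div_le_self (abs_nonneg _) h1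

/-- Compatible subdivisions of the circles of a tower, with mesh tending to zero. -/
structure IsSubdivision (N w : ℕ → ℕ) (F : ℕ → ℤ → ℤ) (g : ℕ → ℤ → ℝ) : Prop where
  strictMono : ∀ i, StrictMono (g i)
  period : ∀ i k, g i (k + N i) = g i k + circumference w i
  mesh : ∀ i k, g i (k + 1) - g i k ≤ 1 / 2 ^ i
  nested : ∀ i k, g i (F i k) ≤ g (i + 1) k ∧ g (i + 1) (k + 1) ≤ g i (F i k + 1)

theorem IsMonotoneTower.exists_isSubdivision {N w : ℕ → ℕ} {F : ℕ → ℤ → ℤ}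
    (h : IsMonotoneTower N w F) : ∃ g, IsSubdivision N w F g := by
  let T : ℕ → Type := fun i => {g : ℤ → ℝ // StrictMono g ∧
    (∀ k, g (k + N i) = g k + circumference w i) ∧ ∀ k, g (k + 1) - g k ≤ 1 / 2 ^ i}
  have hstep : ∀ i (g : T i), ∃ g' : T (i + 1), ∀ k, g.1 (F i k) ≤ g'.1 k ∧
      g'.1 (k + 1) ≤ g.1 (F i k + 1) := by
    rintro i ⟨g, h1, h2, h3⟩
    obtain ⟨g', h4, h5, h6, h7⟩ := exists_subdivision (h.mono i) (h.step i) (h.thick i)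
      (h.period i) (h.degree_pos i) (h.pos i) h1 h2 h3
    refine ⟨⟨g', h4, fun k => ?_, fun k => (h6 k).trans_eq ?_⟩, h7⟩
    · rw [h5, circumference_succ]
    · rw [pow_succ, div_div]
  choose next hnext using hstep
  have hN : (1 : ℝ) ≤ N 0 := by exact_mod_cast h.pos 0
  have hN' : (0 : ℝ) < N 0 := by linarith
  -- The start is `N 0` equal arcs on a circle of length 1.
  let g : ∀ i, T i := fun i => Nat.rec ⟨fun k => k / N 0, fun a b hab => by
      have : (a : ℝ) < b := by exact_mod_cast hab
      simp only
      gcongr, fun k => by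
      simp only [circumference, Finset.range_zero, Finset.prod_empty]
      push_cast
      field_simp, fun k => by
      simp only [pow_zero, div_one]
      rw [← sub_div, div_le_one hN']
      push_cast
      linarith⟩ (fun i g => next i g) i
  exact ⟨fun i => (g i).1, fun i => (g i).2.1, fun i => (g i).2.2.1, fun i => (g i).2.2.2,
    fun i => hnext i (g i)⟩


/-- Coordinates on a space `X` with values in a tower of cycles, such that `X` is the inverse
limit of the tower. -/
structure IsTowerCoordinates {X : Type v} [TopologicalSpace X] {V : ℕ → Type u} (N : ℕ → ℕ)
    (F : ℕ → ℤ → ℤ) (e : ∀ i, ℤ → V i) (q : ∀ i, X → V i) : Prop where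
  surj : ∀ i, Function.Surjective (e i)
  eq_iff : ∀ i j k, e i j = e i k ↔ (N i : ℤ) ∣ k - j
  isLocallyConstant : ∀ i, IsLocallyConstant (q i)
  bond : ∀ i x k, q (i + 1) x = e (i + 1) k → q i x = e i (F i k)
  exists_point : ∀ k : ℕ → ℤ, (∀ i, e i (F i (k (i + 1))) = e i (k i)) →
    ∃ x, ∀ i, q i x = e i (k i)

/-! ### Circle coordinates on a limit of cycles -/

section

variable {X : Type v} [TopologicalSpace X] {V : ℕ → Type u} {N w : ℕ → ℕ} {F : ℕ → ℤ → ℤ}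
  {e : ∀ i, ℤ → V i} {q : ∀ i, X → V i} {g : ℕ → ℤ → ℝ}

namespace IsTowerCoordinates

theorem exists_nested (hq : IsTowerCoordinates N F e q) (hg : IsSubdivision N w F g) (x : X)
    (i j : ℕ) : ∀ k, q (i + j) x = e (i + j) k →
      ∃ l, q i x = e i l ∧ g i l ≤ g (i + j) k ∧ g (i + j) (k + 1) ≤ g i (l + 1) := by
  induction j with
  | zero => exact fun k hk => ⟨k, hk, le_rfl, le_rfl⟩
  | succ j ih =>
    intro k hk
    obtain ⟨l, h1, h2, h3⟩ := ih _ (hq.bond _ _ _ hk)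
    exact ⟨l, h1, h2.trans (hg.nested _ _).1, (hg.nested _ _).2.trans h3⟩

theorem exists_shift (hq : IsTowerCoordinates N F e q) (hg : IsSubdivision N w F g) {i : ℕ}
    {k l : ℤ} (h : e i k = e i l) : ∃ r : ℤ, l = k + r * N i ∧
      ∀ a, g i (l + a) = g i (k + a) + r * circumference w i := by
  obtain ⟨r, hr⟩ := (hq.eq_iff _ _ _).1 h
  have hl : l = k + r * N i := by linarith
  refine ⟨r, hl, fun a => ?_⟩
  rw [hl, add_right_comm, add_mul_period_real (hg.period i)]

/-- This makes `approx` independent of the index chosen for a vertex. It needs `i ≤ j`, where the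
`j`-th circumference is an integer multiple of the `i`-th. -/
theorem wrap_eq (hq : IsTowerCoordinates N F e q) (hg : IsSubdivision N w F g)
    (hw : ∀ i, 1 ≤ w i) {i j : ℕ} (hij : i ≤ j) {k l : ℤ} (h : e j k = e j l) :
    wrap w i (g j k) = wrap w i (g j l) := by
  obtain ⟨r, -, hr⟩ := hq.exists_shift hg h
  have := hr 0
  rw [add_zero, add_zero] at this
  rw [this, wrap_add_mul hw hij]

/-- The approximation to the `i`-th circle coordinate that is visible at stage `j`. -/
noncomputable def approx (hq : IsTowerCoordinates N F e q) (w : ℕ → ℕ) (g : ℕ → ℤ → ℝ)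
    (i j : ℕ) (x : X) : Circle :=
  wrap w i (g j (Function.surjInv (hq.surj j) (q j x)))

theorem approx_eq (hq : IsTowerCoordinates N F e q) (hg : IsSubdivision N w F g)
    (hw : ∀ i, 1 ≤ w i) {i j : ℕ} (hij : i ≤ j) {x : X} {k : ℤ} (h : q j x = e j k) :
    hq.approx w g i j x = wrap w i (g j k) :=
  hq.wrap_eq hg hw hij ((Function.surjInv_eq _ _).trans h)

theorem continuous_approx (hq : IsTowerCoordinates N F e q) (i j : ℕ) :
    Continuous (hq.approx w g i j) :=
  ((hq.isLocallyConstant j).comp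
    fun v => wrap w i (g j (Function.surjInv (hq.surj j) v))).continuous

/-- The two points lie in one interval of stage `i + j`. The bound is written as `C / 2 / 2 ^ j`
with `C = 4 * Real.pi`, the form expected by the geometric Cauchy criterion. -/
theorem dist_approx_le (hq : IsTowerCoordinates N F e q) (hg : IsSubdivision N w F g)
    (hw : ∀ i, 1 ≤ w i) (i j : ℕ) (x : X) :
    dist (hq.approx w g i (i + j) x) (hq.approx w g i (i + (j + 1)) x) ≤
      4 * Real.pi / 2 / 2 ^ j := by
  obtain ⟨k, hk⟩ := hq.surj (i + j + 1) (q (i + j + 1) x)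
  rw [← add_assoc, hq.approx_eq hg hw (by omega) hk.symm,
    hq.approx_eq hg hw (by omega) (hq.bond _ _ _ hk.symm)]
  refine (dist_wrap_le hw _ _ _).trans ?_
  have h1 := hg.nested (i + j) k
  have h2 := hg.strictMono (i + j + 1) (show k < k + 1 by omega)
  have h3 := hg.mesh (i + j) (F (i + j) k)
  have h4 : (1 : ℝ) / 2 ^ (i + j) ≤ 1 / 2 ^ j := by
    gcongr
    · norm_num
    · omega
  have h5 : |g (i + j) (F (i + j) k) - g (i + j + 1) k| ≤ 1 / 2 ^ j := by
    rw [abs_le]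
    constructor <;> linarith
  calc _ ≤ 1 / 2 ^ j * (2 * Real.pi) := by gcongr
    _ = _ := by ring

/-- The `i`-th circle coordinate. -/
noncomputable def circleCoord (hq : IsTowerCoordinates N F e q) (w : ℕ → ℕ) (g : ℕ → ℤ → ℝ)
    (i : ℕ) (x : X) : Circle :=
  limUnder atTop fun j => hq.approx w g i (i + j) x

theorem tendsto_approx (hq : IsTowerCoordinates N F e q) (hg : IsSubdivision N w F g)
    (hw : ∀ i, 1 ≤ w i) (i : ℕ) (x : X) :
    Tendsto (fun j => hq.approx w g i (i + j) x) atTop (𝓝 (hq.circleCoord w g i x)) :=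
  (cauchySeq_of_le_geometric_two fun j => hq.dist_approx_le hg hw i j x).tendsto_limUnder

theorem continuous_circleCoord (hq : IsTowerCoordinates N F e q) (hg : IsSubdivision N w F g)
    (hw : ∀ i, 1 ≤ w i) (i : ℕ) : Continuous (hq.circleCoord w g i) := by
  have hu : TendstoUniformly (fun j => hq.approx w g i (i + j)) (hq.circleCoord w g i) atTop := by
    refine Metric.tendstoUniformly_iff.2 fun ε hε => ?_
    have h1 : Tendsto (fun j : ℕ => 4 * Real.pi / 2 ^ j) atTop (𝓝 0) := by
      have := (tendsto_pow_atTop_nhds_zero_of_lt_one (r := (1 / 2 : ℝ)) (by norm_num)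
        (by norm_num)).const_mul (4 * Real.pi)
      simpa [div_eq_mul_inv] using this
    filter_upwards [h1.eventually_lt_const hε] with j hj x
    rw [dist_comm]
    exact (dist_le_of_le_geometric_two_of_tendsto (fun j => hq.dist_approx_le hg hw i j x)
      (hq.tendsto_approx hg hw i x) j).trans_lt hj
  exact hu.continuous (Frequently.of_forall fun j => hq.continuous_approx _ _)

theorem circleCoord_pow (hq : IsTowerCoordinates N F e q) (hg : IsSubdivision N w F g)
    (hw : ∀ i, 1 ≤ w i) (i : ℕ) (x : X) :
    hq.circleCoord w g (i + 1) x ^ w i = hq.circleCoord w g i x := by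
  refine tendsto_nhds_unique ((hq.tendsto_approx hg hw (i + 1) x).pow (w i)) ?_
  have h := (tendsto_add_atTop_iff_nat 1).2 (hq.tendsto_approx hg hw i x)
  refine h.congr fun j => ?_
  rw [approx, approx, wrap_pow hw, show i + 1 + j = i + (j + 1) by omega]

/-- By nesting, all later approximations lie in this arc; it is taken closed so as to contain their
limit. -/
theorem circleCoord_mem_arc (hq : IsTowerCoordinates N F e q) (hg : IsSubdivision N w F g)
    (hw : ∀ i, 1 ≤ w i) {i : ℕ} {x : X} {k : ℤ} (hk : q i x = e i k) :
    hq.circleCoord w g i x ∈ wrap w i '' Icc (g i k) (g i (k + 1)) := by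
  have hclosed : IsClosed (wrap w i '' Icc (g i k) (g i (k + 1))) :=
    (isCompact_Icc.image (continuous_wrap w i)).isClosed
  refine hclosed.mem_of_tendsto (hq.tendsto_approx hg hw i x) (Eventually.of_forall fun j => ?_)
  obtain ⟨l, hl⟩ := hq.surj (i + j) (q (i + j) x)
  obtain ⟨a, h1, h2, h3⟩ := hq.exists_nested hg x i j l hl.symm
  have h4 := hg.strictMono (i + j) (show l < l + 1 by omega)
  rw [hq.approx_eq hg hw (by omega) hl.symm]
  obtain ⟨r, -, hr⟩ := hq.exists_shift hg (h1.symm.trans hk)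
  have h5 := hr 0
  have h6 := hr 1
  rw [add_zero, add_zero] at h5
  exact ⟨g (i + j) l + r * circumference w i, ⟨by linarith, by linarith⟩,
    wrap_add_mul hw le_rfl _ _⟩

theorem circleCoord_eq_of_near (hq : IsTowerCoordinates N F e q) (hg : IsSubdivision N w F g)
    (hw : ∀ i, 1 ≤ w i) {x y : X}
    (h : ∀ i, ∃ k l, q i x = e i k ∧ q i y = e i l ∧ |l - k| ≤ 1) (i : ℕ) :
    hq.circleCoord w g i x = hq.circleCoord w g i y := by
  refine dist_le_zero.1 (le_of_tendsto_of_tendsto'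
    ((hq.tendsto_approx hg hw i x).dist (hq.tendsto_approx hg hw i y))
    (g := fun j : ℕ => (1 / 2 : ℝ) ^ j * (2 * Real.pi)) ?_ fun j => ?_)
  · simpa using (tendsto_pow_atTop_nhds_zero_of_lt_one (r := (1 / 2 : ℝ)) (by norm_num)
        (by norm_num)).mul_const (2 * Real.pi)
  · obtain ⟨k, l, hk, hl, hkl⟩ := h (i + j)
    rw [hq.approx_eq hg hw (by omega) hk, hq.approx_eq hg hw (by omega) hl]
    refine (dist_wrap_le hw _ _ _).trans ?_
    have h4 : (1 : ℝ) / 2 ^ (i + j) ≤ (1 / 2) ^ j := by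
      rw [div_pow, one_pow]
      gcongr
      · norm_num
      · omega
    have h5 : |g (i + j) k - g (i + j) l| ≤ 1 / 2 ^ (i + j) := by
      rw [abs_le] at hkl
      have h6 := hg.mesh (i + j)
      have h7 := fun k => (hg.strictMono (i + j) (show k < k + 1 by omega))
      obtain rfl | rfl | rfl : k = l ∨ l = k + 1 ∨ k = l + 1 := by omega
      · simp
      · rw [abs_sub_comm, abs_of_pos (sub_pos.2 (h7 _))]
        exact h6 _
      · rw [abs_of_pos (sub_pos.2 (h7 _))]
        exact h6 _
    gcongr
    exact h5.trans h4

/-- Two closed arcs of one partition that share a point have indices at most one apart, once a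
multiple of the period is added. -/
theorem near_of_circleCoord_eq (hq : IsTowerCoordinates N F e q) (hg : IsSubdivision N w F g)
    (hw : ∀ i, 1 ≤ w i) {x y : X} {i : ℕ}
    (h : hq.circleCoord w g i x = hq.circleCoord w g i y) :
    ∃ k l, q i x = e i k ∧ q i y = e i l ∧ |l - k| ≤ 1 := by
  obtain ⟨k, hk⟩ := hq.surj i (q i x)
  obtain ⟨l, hl⟩ := hq.surj i (q i y)
  obtain ⟨s, hs, hs'⟩ := hq.circleCoord_mem_arc hg hw hk.symm
  obtain ⟨t, ht, ht'⟩ := hq.circleCoord_mem_arc hg hw hl.symm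
  obtain ⟨r, rfl⟩ := (wrap_eq_iff hw _ _ _).1 (hs'.trans (h.trans ht'.symm))
  have h1 := add_mul_period_real (hg.period i) l r
  have h2 := add_mul_period_real (hg.period i) (l + 1) r
  refine ⟨k, l + r * N i, hk.symm, ?_, ?_⟩
  · rw [← hl, hq.eq_iff]
    exact ⟨r, by ring⟩
  · have h3 := (hg.strictMono i).le_iff_le (a := k) (b := l + 1 + r * N i)
    have h4 := (hg.strictMono i).le_iff_le (a := l + r * N i) (b := k + 1)
    have h5 := h3.1 (by linarith [hs.1, ht.2])
    have h6 := h4.1 (by linarith [hs.2, ht.1])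
    rw [abs_le]
    omega

theorem exists_circleCoord_eq (hq : IsTowerCoordinates N F e q) (hg : IsSubdivision N w F g)
    (hw : ∀ i, 1 ≤ w i) (z : SolenoidSpace w) :
    ∃ x, ∀ i, hq.circleCoord w g i x = z.1 i := by
  choose t ht using fun i => wrap_surjective hw i (z.1 i)
  have hfloor : ∀ i (s : ℝ), ∃ k, g i k ≤ s ∧ s < g i (k + 1) := by
    intro i s
    have hper := add_mul_period_real (hg.period i) 0
    have h1 := one_le_circumference hw i
    have habs : |s - g i 0| ≤ ⌈|s - g i 0|⌉ := Int.le_ceil _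
    set c := ⌈|s - g i 0|⌉
    have hc : (0 : ℝ) ≤ c := (abs_nonneg _).trans habs
    have h2 : (c : ℝ) ≤ c * circumference w i := le_mul_of_one_le_right hc h1
    have h3 := le_abs_self (s - g i 0)
    have h4 := neg_abs_le (s - g i 0)
    obtain ⟨k, hk, hmax⟩ := Int.exists_greatest_of_bdd (P := fun k => g i k ≤ s)
      ⟨0 + c * N i, fun k hk => by
        by_contra! hlt
        have := hg.strictMono i hlt
        have := hper c
        linarith⟩
      ⟨0 + -c * N i, by
        have := hper (-c)
        push_cast at this
        linarith⟩
    refine ⟨k, hk, ?_⟩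
    by_contra! h
    have := hmax _ h
    omega
  choose k hk hk' using fun i => hfloor i (t i)
  -- Up to `r` turns, `t i` and `t (i + 1)` are the same point, which lies in the half-open
  -- intervals of indices `k i` and `F i (k (i + 1))`. Half-open intervals are disjoint, so the
  -- indices agree modulo the period.
  have hcomp : ∀ i, e i (F i (k (i + 1))) = e i (k i) := by
    intro i
    have h1 : wrap w i (t (i + 1)) = wrap w i (t i) := by
      rw [← wrap_pow hw, ht, ht, z.2]
    obtain ⟨r, hr⟩ := (wrap_eq_iff hw _ _ _).1 h1
    have h2 := add_mul_period_real (hg.period i) (k i) r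
    have h3 := add_mul_period_real (hg.period i) (k i + 1) r
    have h4 := hg.nested i (k (i + 1))
    have h5 := (hg.strictMono i).lt_iff_lt (a := k i + r * N i) (b := F i (k (i + 1)) + 1)
    have h6 := (hg.strictMono i).lt_iff_lt (a := F i (k (i + 1))) (b := k i + 1 + r * N i)
    have h7 := h5.1 (by linarith [hk i, hk' (i + 1)])
    have h8 := h6.1 (by linarith [hk (i + 1), hk' i])
    rw [hq.eq_iff]
    exact ⟨-r, by linarith [show F i (k (i + 1)) = k i + r * N i by omega]⟩
  obtain ⟨x, hx⟩ := hq.exists_point k hcomp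
  refine ⟨x, fun i => ?_⟩
  have hz : ∀ j, wrap w i (t (i + j)) = z.1 i := by
    intro j
    induction j with
    | zero => exact ht i
    | succ j ih =>
      have h1 : wrap w (i + j) (t (i + j + 1)) = wrap w (i + j) (t (i + j)) := by
        rw [← wrap_pow hw, ht, ht, z.2]
      obtain ⟨r, hr⟩ := (wrap_eq_iff hw _ _ _).1 h1
      rw [← add_assoc, hr, wrap_add_mul hw (by omega), ih]
  refine dist_le_zero.1 (le_of_tendsto_of_tendsto'
    ((hq.tendsto_approx hg hw i x).dist (tendsto_const_nhds (x := z.1 i)))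
    (g := fun j : ℕ => (1 / 2 : ℝ) ^ j * (2 * Real.pi)) ?_ fun j => ?_)
  · simpa using (tendsto_pow_atTop_nhds_zero_of_lt_one (r := (1 / 2 : ℝ)) (by norm_num)
        (by norm_num)).mul_const (2 * Real.pi)
  · rw [hq.approx_eq hg hw (by omega) (hx _), ← hz j]
    refine (dist_wrap_le hw _ _ _).trans ?_
    have h4 : (1 : ℝ) / 2 ^ (i + j) ≤ (1 / 2) ^ j := by
      rw [div_pow, one_pow]
      gcongr
      · norm_num
      · omega
    have h5 : |g (i + j) (k (i + j)) - t (i + j)| ≤ 1 / 2 ^ (i + j) := by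
      have h6 := hg.mesh (i + j) (k (i + j))
      have h7 := hk (i + j)
      have h8 := hk' (i + j)
      rw [abs_le]
      constructor <;> linarith
    gcongr
    exact h5.trans h4

/-- A compact space with coordinates in a tower of cycles, modulo adjacency, is a solenoid. -/
theorem nonempty_homeomorph [CompactSpace X] (hq : IsTowerCoordinates N F e q)
    (hT : IsMonotoneTower N w F) (s : Setoid X)
    (hs : ∀ x y, s x y ↔ ∀ i, ∃ k l, q i x = e i k ∧ q i y = e i l ∧ |l - k| ≤ 1) :
    Nonempty (Quotient s ≃ₜ SolenoidSpace w) := by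
  obtain ⟨g, hg⟩ := hT.exists_isSubdivision
  have hw := hT.degree_pos
  let Φ : X → SolenoidSpace w := fun x =>
    ⟨fun i => hq.circleCoord w g i x, fun i => hq.circleCoord_pow hg hw i x⟩
  have hΦ : Continuous Φ :=
    Continuous.subtype_mk (continuous_pi fun i => hq.continuous_circleCoord hg hw i) _
  have hΦs : ∀ x y, s x y → Φ x = Φ y := fun x y h =>
    Subtype.ext (funext fun i => hq.circleCoord_eq_of_near hg hw ((hs x y).1 h) i)
  have hbij : Function.Bijective (Quotient.lift Φ hΦs) := by
    constructor
    · intro a b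
      induction a using Quotient.inductionOn
      induction b using Quotient.inductionOn
      rename_i x y
      intro h
      refine Quotient.sound ((hs x y).2 fun i => hq.near_of_circleCoord_eq hg hw ?_)
      exact congrFun (congrArg Subtype.val h) i
    · intro z
      obtain ⟨x, hx⟩ := hq.exists_circleCoord_eq hg hw z
      exact ⟨Quotient.mk s x, Subtype.ext (funext hx)⟩
  exact ⟨Continuous.homeoOfEquivCompactToT2 (f := Equiv.ofBijective _ hbij) (hΦ.quotient_lift hΦs)⟩

end IsTowerCoordinates
end

/-! ### Thick and winding stages, and the realization -/

namespace GraphClass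

variable {D : GraphClass.{u}}

theorem IsClassOfCycles.exists_domain_enum (hcyc : D.IsClassOfCycles) {A B : FinGraph.{u}}
    (hA : A ∈ D.obj) (hB : B ∈ D.obj) {f : A.V → B.V} (hf : f ∈ D.epi A B) {n : ℕ}
    {eB : ℤ → B.V} (he : CyclicEnum B n eB) : ∃ m eA F w, CyclicEnum A m eA ∧
      IsLift m n eA eB f F w ∧ Monotone F ∧ 0 < w :=
  IsLift.exists_domain_enum (hcyc.1 A hA) he (D.isEpimorphism A hA B hB f hf)
    (hcyc.2 A hA B hB f hf)

namespace InverseSequence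

variable {S : D.InverseSequence}

/-- A lift out of the limit is defined at some finite stage. Since every vertex of a stage extends
to a thread, the equation on the limit descends to that stage. -/
theorem IsLimiting.exists_factorization (hS : S.IsLimiting) (hD : D.IsProjectiveFraisse)
    {A B : FinGraph.{u}} (hA : A ∈ D.obj) (hB : B ∈ D.obj) {n : ℕ} {φ : (S.F n).V → A.V}
    (hφ : φ ∈ D.epi (S.F n) A) {g : B.V → A.V} (hg : g ∈ D.epi B A) (p : ℕ) :
    ∃ m, p ≤ m ∧ ∃ h : n ≤ m, ∃ ψ ∈ D.epi (S.F m) B, φ ∘ S.bond n h = g ∘ ψ := by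
  obtain ⟨f, ⟨k, ψ, hψ, hf⟩, hcomm⟩ := hS.lifting A hA B hB (fun x => φ (x.1 n))
    ⟨n, φ, hφ, fun _ => rfl⟩ g hg
  have h1 : k ≤ max k (max n p) := by omega
  have h2 : n ≤ max k (max n p) := by omega
  refine ⟨max k (max n p), by omega, h2, ψ ∘ S.bond k h1,
    hD.comp_mem _ (S.F_mem _) _ (S.F_mem _) _ hB _ (S.bond_mem hD h1) _ hψ, funext fun v => ?_⟩
  obtain ⟨x, rfl⟩ := S.exists_thread _ v
  have h3 := congrFun hcomm x
  simp only [Function.comp_apply, bond_thread]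
  exact h3.trans (congrArg g (hf x))

/-- Every stage has a later stage, with a compatible enumeration, over which all components of
vertex fibres have at least two vertices. -/
theorem IsLimiting.exists_thick_stage (hS : S.IsLimiting) (hD : D.IsProjectiveFraisse)
    (hcyc : D.IsClassOfCycles) (hthick : D.HasThickPreimages) {n N : ℕ} {e : ℤ → (S.F n).V}
    (he : CyclicEnum (S.F n) N e) : ∃ m, n < m ∧ ∃ (h : n ≤ m) (M : ℕ) (e' : ℤ → (S.F m).V)
      (F : ℤ → ℤ) (w : ℤ), CyclicEnum (S.F m) M e' ∧ IsLift M N e' e (S.bond n h) F w ∧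
        Monotone F ∧ 0 < w ∧ ∀ k, F (k + 2) ≤ F k + 1 := by
  obtain ⟨B, hB, f, hf, hfthick⟩ := hthick _ (S.F_mem n)
  obtain ⟨b, eB, F, w, hbe, hF, hFm, hw⟩ := hcyc.exists_domain_enum hB (S.F_mem n) hf he
  -- The identity of the stage is factored through the thick map; the bound `n + 1` makes the new
  -- stage strictly later.
  obtain ⟨m, hm, h, ψ, hψ, hcomm⟩ :=
    hS.exists_factorization hD (S.F_mem n) hB (hD.id_mem _ (S.F_mem n)) hf (n + 1)
  obtain ⟨M, e', G, v, hMe, hG, hGm, hv⟩ := hcyc.exists_domain_enum (S.F_mem m) hB hψ hbe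
  refine ⟨m, hm, h, M, e', F ∘ G, v * w, hMe, ?_, hFm.comp hGm, mul_pos hv hw, fun k => ?_⟩
  · rw [Function.id_comp] at hcomm
    rw [hcomm]
    exact hG.comp hF
  · have h1 := hG.step k
    have h2 := hG.step (k + 1)
    rw [add_assoc, one_add_one_eq_two] at h2
    rw [abs_le] at h1 h2
    exact (hFm (show G (k + 2) ≤ G k + 2 by omega)).trans
      (hF.le_add_one_of_thick hbe he hfthick _)

/-- At a thick stage above `n`, the indices of `x` and `z` can be chosen within 2 of each other, and
the monotone bonding lift brings them within 1. -/
theorem IsLimiting.adj_trans (hS : S.IsLimiting) (hD : D.IsProjectiveFraisse)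
    (hcyc : D.IsClassOfCycles) (hthick : D.HasThickPreimages) {x y z : S.Thread}
    (hxy : S.limit.Adj x y) (hyz : S.limit.Adj y z) : S.limit.Adj x z := by
  intro n
  obtain ⟨N, e, he⟩ := (hcyc.1 _ (S.F_mem n)).exists_cyclicEnum
  obtain ⟨m, -, h, M, e', F, w, he', hF, hFm, -, hFt⟩ :=
    hS.exists_thick_stage hD hcyc hthick he
  obtain ⟨k, hk⟩ := he'.surj (y.1 m)
  obtain ⟨i, hi, hxi⟩ := he'.exists_near (hk ▸ (S.F m).symm _ _ (hxy m))
  obtain ⟨j, hj, hzj⟩ := he'.exists_near (hk ▸ hyz m)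
  rw [← S.bond_thread x h, ← S.bond_thread z h, hxi, hzj, hF.map, hF.map]
  refine he.adj_of_abs_le ?_
  rw [abs_le] at *
  have h1 := hFm (show j ≤ i + 2 by omega)
  have h2 := hFm (show i ≤ j + 2 by omega)
  have h3 := hFt i
  have h4 := hFt j
  omega

/-- If infinitely many integers are winding numbers onto a single member, then every stage is
wrapped around at least twice by a later stage. -/
theorem IsLimiting.exists_winding_stage (hS : S.IsLimiting) (hD : D.IsProjectiveFraisse)
    (hcyc : D.IsClassOfCycles) {C : FinGraph.{u}} (hC : C ∈ D.obj)
    (hinf : (D.windingNumbersOnto C).Infinite) {n N : ℕ} {e : ℤ → (S.F n).V}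
    (he : CyclicEnum (S.F n) N e) : ∃ m, ∃ (h : n ≤ m) (M : ℕ) (e' : ℤ → (S.F m).V)
      (F : ℤ → ℤ) (w : ℤ), CyclicEnum (S.F m) M e' ∧ IsLift M N e' e (S.bond n h) F w ∧
        Monotone F ∧ 2 ≤ w := by
  obtain ⟨-, j, φ, hφ, -⟩ := hS.onto C hC
  have hnp : n ≤ max n j := le_max_left _ _
  have hjp : j ≤ max n j := le_max_right _ _
  set p := max n j
  obtain ⟨P, ep, F₁, w₁, hep, hF₁, hF₁m, hw₁⟩ :=
    hcyc.exists_domain_enum (S.F_mem p) (S.F_mem n) (S.bond_mem hD hnp) he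
  have hφp : φ ∘ S.bond j hjp ∈ D.epi (S.F p) C :=
    hD.comp_mem _ (S.F_mem _) _ (S.F_mem _) _ hC _ (S.bond_mem hD hjp) _ hφ
  obtain ⟨c, eC, F₂, w₂, heC, hF₂, hF₂m, hw₂⟩ := IsLift.exists_codomain_enum hep (hcyc.1 C hC)
    (D.isEpimorphism _ (S.F_mem p) _ hC _ hφp) (hcyc.2 _ (S.F_mem p) _ hC _ hφp)
  -- The winding number is chosen above the degree `w₂` of the map from stage `p` to `C`.
  obtain ⟨W, ⟨B, hB, g, hg, hgW⟩, hW⟩ := hinf.exists_gt w₂.toNat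
  obtain ⟨b, eB, F₃, w₃, heB, hF₃, hF₃m, hw₃⟩ := hcyc.exists_domain_enum hB hC hg heC
  have hWw := hF₃.windingNumber_le heB heC hF₃m hw₃ hgW
  obtain ⟨m, -, hpm, ψ, hψ, hcomm⟩ := hS.exists_factorization hD hC hB hφp hg p
  obtain ⟨M, em, F₄, w₄, hem, hF₄, hF₄m, hw₄⟩ := hcyc.exists_domain_enum (S.F_mem m) hB hψ heB
  obtain ⟨F₅, w₅, hF₅, hF₅m⟩ := IsLift.exists_of_confluent hem hep
    (D.isEpimorphism _ (S.F_mem m) _ (S.F_mem p) _ (S.bond_mem hD hpm))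
    (hcyc.2 _ (S.F_mem m) _ (S.F_mem p) _ (S.bond_mem hD hpm))
  -- Both products are the degree of the same map from stage `m` to `C`. As `w₄ * w₃ ≥ W > w₂`, a
  -- bonding degree of at most 1 is impossible.
  have hdeg : w₅ * w₂ = w₄ * w₃ := (hF₅.comp hF₂).degree_unique heC (hcomm ▸ hF₄.comp hF₃)
  have h43 : w₃ ≤ w₄ * w₃ := le_mul_of_one_le_left hw₃.le hw₄
  have hw₅ : 2 ≤ w₅ := by
    by_contra! h
    have : w₅ * w₂ ≤ 1 * w₂ := mul_le_mul_of_nonneg_right (by omega) hw₂.le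
    omega
  refine ⟨m, hnp.trans hpm, M, em, F₁ ∘ F₅, w₅ * w₁, hem, ?_, ?_, ?_⟩
  · rw [← S.bond_comp hnp hpm]
    exact hF₅.comp hF₁
  · exact hF₁m.comp (hF₅m.resolve_right fun h => by omega).1
  · exact hw₅.trans (le_mul_of_one_le_right (by omega) hw₁)

/-- If every stage can be wrapped with thick fibres and degree at least `c` by a later stage, then
the realization of the limit is a solenoid with exponents at least `c`. -/
theorem exists_homeomorph_solenoidSpace (hcyc : D.IsClassOfCycles) (c : ℤ)
    (H : ∀ (n N : ℕ) (e : ℤ → (S.F n).V), CyclicEnum (S.F n) N e →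
      ∃ m, n < m ∧ ∃ (h : n ≤ m) (M : ℕ) (e' : ℤ → (S.F m).V) (F : ℤ → ℤ) (w : ℤ),
        CyclicEnum (S.F m) M e' ∧ IsLift M N e' e (S.bond n h) F w ∧
        Monotone F ∧ 0 < w ∧ (∀ k, F (k + 2) ≤ F k + 1) ∧ c ≤ w)
    {K : TopGraph.{v}} (hK : K.Isomorphic S.limit)
    (htrans : ∀ a b c, K.Adj a b → K.Adj b c → K.Adj a c) :
    ∃ w : ℕ → ℕ, (∀ i, 1 ≤ w i ∧ c ≤ w i) ∧
      Nonempty (K.Realization htrans ≃ₜ SolenoidSpace w) := by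
  obtain ⟨E, hE⟩ := hK
  let St := {p : Σ n, ℕ × (ℤ → (S.F n).V) // CyclicEnum (S.F p.1) p.2.1 p.2.2}
  have hstep : ∀ p : St, ∃ p' : St, ∃ h : p.1.1 < p'.1.1, ∃ (F : ℤ → ℤ) (w : ℤ),
      IsLift p'.1.2.1 p.1.2.1 p'.1.2.2 p.1.2.2 (S.bond p.1.1 h.le) F w ∧ Monotone F ∧ 0 < w ∧
      (∀ k, F (k + 2) ≤ F k + 1) ∧ c ≤ w := by
    rintro ⟨⟨n, N, e⟩, he⟩
    obtain ⟨m, hm, h, M, e', F, w, he', hF⟩ := H n N e he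
    exact ⟨⟨⟨m, M, e'⟩, he'⟩, hm, F, w, hF⟩
  choose next hlt F w hlift hmono hpos hthick hc using hstep
  obtain ⟨N₀, e₀, he₀⟩ := (hcyc.1 _ (S.F_mem 0)).exists_cyclicEnum
  -- A state carries its enumeration along, so that consecutive bonding maps have monotone lifts in
  -- common coordinates.
  let p : ℕ → St := fun i => Nat.rec ⟨⟨0, N₀, e₀⟩, he₀⟩ (fun _ p => next p) i
  have hlt' : ∀ i, (p i).1.1 < (p (i + 1)).1.1 := fun i => hlt (p i)
  have hσ : StrictMono fun i => (p i).1.1 := strictMono_nat_of_lt_succ hlt'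
  have hl : ∀ i, IsLift (p (i + 1)).1.2.1 (p i).1.2.1 (p (i + 1)).1.2.2 (p i).1.2.2
      (S.bond (p i).1.1 (hlt' i).le) (F (p i)) (w (p i)) := fun i => hlift (p i)
  have hwcast : ∀ i, ((w (p i)).toNat : ℤ) = w (p i) := fun i => Int.toNat_of_nonneg (hpos _).le
  have hT : IsMonotoneTower (fun i => (p i).1.2.1) (fun i => (w (p i)).toNat)
      (fun i => F (p i)) :=
    { pos := fun i => by have := (p i).2.three_le; omega
      degree_pos := fun i => by have := hpos (p i); omega
      mono := fun i => hmono _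
      step := fun i k => by
        have := (hl i).step k
        rw [abs_le] at this
        omega
      thick := fun i => hthick _
      period := fun i k => by rw [hwcast, (hl i).period] }
  let q : ∀ i, K.V → (S.F (p i).1.1).V := fun i x => (show S.Thread from E x).1 (p i).1.1
  have hq : IsTowerCoordinates (fun i => (p i).1.2.1) (fun i => F (p i))
      (fun i => (p i).1.2.2) q :=
    { surj := fun i => (p i).2.surj
      eq_iff := fun i => (p i).2.eq_iff
      isLocallyConstant := fun i => (IsLocallyConstant.iff_continuous _).2
        ((continuous_apply _).comp (continuous_subtype_val.comp E.continuous))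
      bond := fun i x k hk => by
        rw [← (hl i).map, ← hk]
        exact (S.bond_thread _ _).symm
      exists_point := fun k hk => by
        obtain ⟨x, hx⟩ := S.exists_thread_of_cofinal hσ (fun i => (p i).1.2.2 (k i))
          (fun i => ((hl i).map _).trans (hk i))
        obtain ⟨y, hy⟩ := E.surjective x
        refine ⟨y, fun i => ?_⟩
        rw [← hx]
        exact congrArg (fun z : S.Thread => z.1 (p i).1.1) hy }
  have := K.compact
  refine ⟨fun i => (w (p i)).toNat, fun i => ⟨hT.degree_pos i, (hc (p i)).trans_eq (hwcast i).symm⟩,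
    hq.nonempty_homeomorph hT _ fun x y => ?_⟩
  refine (hE x y).trans ⟨fun h i => ?_, fun h n => ?_⟩
  · obtain ⟨k, hk⟩ := (p i).2.surj (q i x)
    obtain ⟨l, hkl, hl⟩ := (p i).2.exists_near (x := q i y) (i := k) (hk ▸ h (p i).1.1)
    exact ⟨k, l, hk.symm, hl, hkl⟩
  · obtain ⟨k, l, hk, hl, hkl⟩ := h n
    have hadj : (S.F (p n).1.1).Adj (q n x) (q n y) := by
      rw [hk, hl]
      exact (p n).2.adj_of_abs_le hkl
    -- Chosen stages are cofinal, and adjacency passes down the bonding maps, so adjacency at the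
    -- chosen stages suffices.
    have hn : n ≤ (p n).1.1 := hσ.le_apply
    have hbond : ∀ v v', (S.F (p n).1.1).Adj v v' →
        (S.F n).Adj (S.bond n hn v) (S.bond n hn v') := by
      generalize (p n).1.1 = m at hn
      induction m, hn using Nat.le_induction with
      | base => simp
      | succ m hm ih =>
        intro v v' hv
        rw [S.bond_succ hm]
        exact ih _ _ ((D.isEpimorphism _ (S.F_mem _) _ (S.F_mem _) _ (S.α_mem m)).1 _ _ hv)
    have h1 := hbond _ _ hadj
    have h2 : ∀ z : K.V, S.bond n hn (q n z) = (show S.Thread from E z).1 n :=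
      fun z => S.bond_thread _ hn
    rw [h2, h2] at h1
    exact h1

end InverseSequence
end GraphClass
end FraisseCycles

open FraisseCycles GraphClass InverseSequence in
theorem mainTheorem12 (D : FraisseCycles.GraphClass.{u})
    (hD : D.IsProjectiveFraisse) (hcyc : D.IsClassOfCycles)
    (hthick : D.HasThickPreimages) (hW : D.windingNumbers.Infinite) :
    (∃ K : FraisseCycles.TopGraph.{u}, D.IsProjectiveFraisseLimit K) ∧
    ∀ K : FraisseCycles.TopGraph.{v}, D.IsProjectiveFraisseLimit K →
      ∃ htrans : ∀ a b c, K.Adj a b → K.Adj b c → K.Adj a c,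
        FraisseCycles.IsSolenoid (K.Realization htrans) ∧
        ((∃ C ∈ D.obj, (D.windingNumbersOnto C).Infinite) →
          FraisseCycles.IsNontrivialSolenoid (K.Realization htrans)) := by
  obtain ⟨-, C₀, hC₀, -⟩ := hW.nonempty
  refine ⟨exists_isProjectiveFraisseLimit hD ⟨C₀, hC₀⟩, ?_⟩
  rintro K ⟨S, hK, hS⟩
  have htrans : ∀ a b c, K.Adj a b → K.Adj b c → K.Adj a c := by
    obtain ⟨E, hE⟩ := hK
    intro a b c hab hbc
    exact (hE a c).2 (hS.adj_trans hD hcyc hthick ((hE a b).1 hab) ((hE b c).1 hbc))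
  refine ⟨htrans, ?_, ?_⟩
  · obtain ⟨w, hw, hhom⟩ := exists_homeomorph_solenoidSpace hcyc 1 (fun n N e he => by
      obtain ⟨m, hm, h, M, e', F, w, he', hF, hFm, hpos, hFt⟩ :=
        hS.exists_thick_stage hD hcyc hthick he
      exact ⟨m, hm, h, M, e', F, w, he', hF, hFm, hpos, hFt, hpos⟩) hK htrans
    exact ⟨w, fun i => (hw i).1, hhom⟩
  · rintro ⟨C, hC, hinf⟩
    obtain ⟨w, hw, hhom⟩ := exists_homeomorph_solenoidSpace hcyc 2 (fun n N e he => by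
      obtain ⟨m, h, M, e', F, w, he', hF, hFm, hw⟩ :=
        -- A winding stage followed by a thick stage is both: degrees multiply, and a monotone lift
        -- with steps at most one keeps the thickness bound.
        hS.exists_winding_stage hD hcyc hC hinf he
      obtain ⟨m', hm', h', M', e'', F', w', he'', hF', hFm', hpos', hFt'⟩ :=
        hS.exists_thick_stage hD hcyc hthick he'
      refine ⟨m', h.trans_lt hm', h.trans h', M', e'', F ∘ F', w' * w, he'', ?_, hFm.comp hFm',
        mul_pos hpos' (by omega), fun k => ?_, ?_⟩
      · rw [← S.bond_comp h h']
        exact hF'.comp hF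
      · have h1 := hF.step (F' k)
        rw [abs_le] at h1
        have h2 := hFm (hFt' k)
        simp only [Function.comp_apply]
        omega
      · exact hw.trans (le_mul_of_one_le_left (by omega) hpos')) hK htrans
    exact ⟨w, fun i => by exact_mod_cast (hw i).2, hhom⟩
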